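/- Identify $\mathbb{R}^2$ with $\mathbb{C}$. Let $\mathcal{E}$ be an ellipse with foci $F_1,F_2$, and let $\mathcal{E}_c$ be an ellipse with foci $G_1,G_2$ lying in the open region bounded by $\mathcal{E}$ (circles are allowed as ellipses). Assume that there is a triangle inscribed in $\mathcal{E}$ and circumscribed about $\mathcal{E}_c$, and let $\mathcal{T}$ be the (Poncelet) family of all triangles inscribed in $\mathcal{E}$ whose three sidelines are tangent to $\mathcal{E}_c$. For a point $P$ and a triangle, the isogonal conjugate $P^\dagger$ of $P$ is the point of concurrence, when it exists, of the three lines joining $P$ to the vertices, each reflected in the angle bisector at its vertex. Fix $P\in\mathbb{C}$ and let $\mathcal{L}^\dagger$ be the locus of $P^\dagger$ over $\mathcal{T}$. Then $\mathcal{L}^\dagger$ is a (possibly degenerate) conic in the following sense. 1. If $P\notin\mathcal{E}$ and $P\ne G_1,G_2$, then $\mathcal{L}^\dagger$ is a nondegenerate real conic (the full set of real points of an ellipse, circle, parabola or hyperbola). 2. If $P=G_1$, then $\mathcal{L}^\dagger=\{G_2\}$; if $P=G_2$, then $\mathcal{L}^\dagger=\{G_1\}$. 3. If $P\in\mathcal{E}$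 and $\mathcal{E}$ is not a circle, then $\mathcal{L}^\dagger$ is a line with at most one point removed. Moreover, let $\mathcal{A}$ be any invertible real-affine map of $\mathbb{C}$ taking the unit circle to $\mathcal{E}$, and to a triangle $ABC$ in $\mathcal{T}$ assign the parameter $\lambda=\mathcal{A}^{-1}(A)\,\mathcal{A}^{-1}(B)\,\mathcal{A}^{-1}(C)$. Then there are complex polynomials $S,T$ of degree at most $2$ such that: 4. for every triangle in $\mathcal{T}$ with parameter $\lambda$, the point $P^\dagger$ exists if and only if $T(\lambda)\neq0$, and then $P^\dagger=S(\lambda)/T(\lambda)$; moreover $\mathcal{L}^\dagger=\{S(\lambda)/T(\lambda): |\lambda|=1,\ T(\lambda)\ne0\}$; 5. put $S^*(\lambda)=\lambda^2\,\overline{S(1/\overline\lambda)}$ and likewise $T^*$. The polynomial in $x,y$ obtained by eliminating $\lambda$, namely $$R(x,y)=\operatorname{Res}_\lambda\bigl(S-(x+iy)T,\ S^*-(x-iy)T^*\bigr)$$ (with formal degrees $2,2$), which a priori has degree up to $4$, has total degree at most $2$; in particular its quartic (and cubic) coefficients vanish. If $P\notin\mathcal{E}$ and $P\ne G_1,G_2$,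 then $R\neq0$ and $\mathcal{L}^\dagger=\{x+iy : x,y\in\mathbb{R},\ R(x,y)=0\}$. -/

import Mathlib

open Polynomial

noncomputable section

/-- The ellipse in the plane `ℂ = ℝ²` with foci `F`, `G` and major axis of length `s`
(a circle if `F = G`); it is a proper ellipse as soon as `dist F G < s`. -/
def ellipse (F G : ℂ) (s : ℝ) : Set ℂ := {z | dist z F + dist z G = s}

/-- The open region bounded by `ellipse F G s`. -/
def ellipseInterior (F G : ℂ) (s : ℝ) : Set ℂ := {z | dist z F + dist z G < s}

/-- The line `XY` is tangent to the ellipse `K`: it meets `K` in exactly one point. -/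
def IsTangentLine (K : Set ℂ) (X Y : ℂ) : Prop :=
  ∃! Z : ℂ, Z ∈ line[ℝ, X, Y] ∧ Z ∈ K

/-- `ABC` is a (nondegenerate) triangle inscribed in `E` whose three sidelines are tangent
to `K`. -/
structure IsPonceletTriangle (E K : Set ℂ) (A B C : ℂ) : Prop where
  affineIndependent : AffineIndependent ℝ ![A, B, C]
  mem_A : A ∈ E
  mem_B : B ∈ E
  mem_C : C ∈ E
  tangent_AB : IsTangentLine K A B
  tangent_BC : IsTangentLine K B C
  tangent_CA : IsTangentLine K C A

/-- The internal bisector of the angle `BAC`: the line through `A` whose direction is the sum of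
the unit vectors pointing from `A` to `B` and from `A` to `C`. -/
def angleBisector (A B C : ℂ) : AffineSubspace ℝ ℂ :=
  AffineSubspace.mk' A
    (Submodule.span ℝ {(‖B - A‖⁻¹ : ℝ) • (B - A) + (‖C - A‖⁻¹ : ℝ) • (C - A)})

instance angleBisector_nonempty (A B C : ℂ) : Nonempty (angleBisector A B C) :=
  ⟨⟨A, AffineSubspace.self_mem_mk' _ _⟩⟩

/-- The cevian `AP` of the triangle `ABC`, reflected in the bisector of the angle at `A`
(which passes through `A`). -/
def reflectedCevian (A B C P : ℂ) : AffineSubspace ℝ ℂ :=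
  line[ℝ, A, EuclideanGeometry.reflection (angleBisector A B C) P]

/-- `Q` is the isogonal conjugate of `P` with respect to the triangle `ABC`: the three cevians of
`P`, each reflected in the angle bisector at its vertex, concur at `Q`. -/
structure IsIsogonalConjugate (A B C P Q : ℂ) : Prop where
  ne_A : P ≠ A
  ne_B : P ≠ B
  ne_C : P ≠ C
  mem_A : Q ∈ reflectedCevian A B C P
  mem_B : Q ∈ reflectedCevian B C A P
  mem_C : Q ∈ reflectedCevian C A B P

/-- The locus of the isogonal conjugate of `P` over all triangles inscribed in `E` and
circumscribed about `K`. -/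
def isogonalLocus (E K : Set ℂ) (P : ℂ) : Set ℂ :=
  {Q | ∃ A B C : ℂ, IsPonceletTriangle E K A B C ∧ IsIsogonalConjugate A B C P Q}

/-- `K` is a nondegenerate real conic (an ellipse, a circle, a parabola or a hyperbola): the
nonempty set of all real zeros of a quadratic equation whose symmetric `3 × 3` matrix is
invertible. -/
def IsNondegenerateConic (K : Set ℂ) : Prop :=
  K.Nonempty ∧ ∃ q : Matrix (Fin 3) (Fin 3) ℝ, q.IsSymm ∧ q.det ≠ 0 ∧
    K = {z : ℂ | ![z.re, z.im, 1] ⬝ᵥ q.mulVec ![z.re, z.im, 1] = 0}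

/-- `K` is a line from which at most one point has been removed. -/
def IsLineUpToPoint (K : Set ℂ) : Prop :=
  ∃ X Y Q : ℂ, X ≠ Y ∧ (line[ℝ, X, Y] : Set ℂ) \ {Q} ⊆ K ∧ K ⊆ (line[ℝ, X, Y] : Set ℂ)

/-- The parameter `λ` of a triangle inscribed in the image of the unit circle under the affine
map `𝒜`: the product of the three unit complex numbers which `𝒜` maps to its vertices. -/
def triangleParameter (𝒜 : ℂ ≃ᵃ[ℝ] ℂ) (A B C : ℂ) : ℂ :=
  𝒜.symm A * 𝒜.symm B * 𝒜.symm C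

/-- For `S = s₂λ² + s₁λ + s₀` this is `conj s₀ λ² + conj s₁ λ + conj s₂`; on the unit circle it
equals `λ²` times the complex conjugate of `S(λ)`. -/
def conjReciprocal (S : ℂ[X]) : ℂ[X] := (S.map (starRingEnd ℂ)).reflect 2

/-- The polynomial in the real coordinates `x = X 0`, `y = X 1` obtained by eliminating `λ` from
`x + iy = S(λ)/T(λ)` and its complex conjugate, for `|λ| = 1`: the resultant in `λ` of
`S - (x + iy) T` and `S* - (x - iy) T*`, both of formal degree `2`. It is the determinant of a
`4 × 4` matrix with entries of degree at most `1` in `x, y`. -/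
def eliminant (S T : ℂ[X]) : MvPolynomial (Fin 2) ℂ :=
  Polynomial.resultant
    (S.map MvPolynomial.C -
      C (MvPolynomial.X 0 + MvPolynomial.C Complex.I * MvPolynomial.X 1) * T.map MvPolynomial.C)
    ((conjReciprocal S).map MvPolynomial.C -
      C (MvPolynomial.X 0 - MvPolynomial.C Complex.I * MvPolynomial.X 1) *
        (conjReciprocal T).map MvPolynomial.C)
    2 2

end

open scoped ComplexConjugate

noncomputable section

/-! An affine map `z ↦ p z + q z̄ + c` carries the unit circle to the outer ellipse. In these
coordinates the inner ellipse has a dual conic with coefficients `m = f + g` and `n = f g`. Poncelet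
closure for a single triangle fixes its remaining coefficient, and nestedness puts `f` and `g` in
the open disc. The triangles of the family are then exactly the fibres over unimodular `λ` of the
cubic Blaschke product with zeros `0, f, g` (`exists_blaschke_of_poncelet`,
`exists_isBlaschkeTriple`). Their vertices enter only through `a + b + c = m + λ n̄`, `ab + bc + ca
= n + λ m̄` and `abc = λ`.

Reflection in an angle bisector is `x ↦ x̄` followed by multiplication by a product of side
directions, so the three reflected cevians can be handled by algebra. Reducing by the cubic of the
vertices gives one formula `S(λ)/T(λ)` with quadratic `S, T` for the isogonal conjugate of a fixed
point (`IsBlaschkeTriple.isIsogonalConjugate_iff`).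

The decisive fact is that `T` is self-reciprocal, so `T(λ)/λ` is real on the circle. Hence `λ ↦ S/T`
is the restriction to the circle of a real projective map of the plane, and its image is a conic as
soon as the determinant is nonzero. The same symmetry cancels the top-degree terms of the eliminant.
By `circleDet_isogonal` the determinant splits into factors that vanish only for `P` on the outer
ellipse or at a focus of the inner one.

The exceptional cases are direct. The two foci are isogonal in every triangle of the family, because
`(G₁ - A)(G₂ - A)` is a real multiple of `(B - A)(C - A)`. For `P` on a noncircular outer ellipse,
`S` and `T` share a linear factor, and what remains is a nonconstant Möbius map with its pole on the
unit circle, so the image is a line. -/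

/-! ### Cubic Blaschke products and their fibres on the unit circle -/

/-- The two sides of the Blaschke factor `(z - f) / (1 - f̄ z)`. -/
theorem normSq_one_sub_conj_mul (f z : ℂ) :
    ‖1 - conj f * z‖ ^ 2 - ‖z - f‖ ^ 2 = (1 - ‖f‖ ^ 2) * (1 - ‖z‖ ^ 2) := by
  simp only [← Complex.normSq_eq_norm_sq, Complex.normSq_apply]
  simp
  ring

theorem norm_sub_lt_of_norm_lt_one {f z : ℂ} (hf : ‖f‖ < 1) (hz : ‖z‖ < 1) :
    ‖z - f‖ < ‖1 - conj f * z‖ := by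
  have h := normSq_one_sub_conj_mul f z
  have : 0 < (1 - ‖f‖ ^ 2) * (1 - ‖z‖ ^ 2) :=
    mul_pos (by nlinarith [norm_nonneg f]) (by nlinarith [norm_nonneg z])
  exact lt_of_pow_lt_pow_left₀ 2 (norm_nonneg _) (by linarith)

theorem lt_norm_sub_of_one_lt_norm {f z : ℂ} (hf : ‖f‖ < 1) (hz : 1 < ‖z‖) :
    ‖1 - conj f * z‖ < ‖z - f‖ := by
  have h := normSq_one_sub_conj_mul f z
  have : 0 < (1 - ‖f‖ ^ 2) * (‖z‖ ^ 2 - 1) :=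
    mul_pos (by nlinarith [norm_nonneg f]) (by nlinarith [norm_nonneg z])
  exact lt_of_pow_lt_pow_left₀ 2 (norm_nonneg _) (by linarith)

theorem mul_conj_of_norm_eq_one {a : ℂ} (ha : ‖a‖ = 1) : a * conj a = 1 := by
  rw [Complex.mul_conj']; simp [ha]

theorem exists_add_eq_mul_eq (m n : ℂ) : ∃ f g : ℂ, f + g = m ∧ f * g = n := by
  obtain ⟨d, hd⟩ := IsAlgClosed.exists_pow_nat_eq (m ^ 2 - 4 * n) (n := 2) (by norm_num)
  exact ⟨(m + d) / 2, (m - d) / 2, by ring, by linear_combination (-1 / 4 : ℂ) * hd⟩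

theorem exists_cubic_roots (s₁ s₂ s₃ : ℂ) :
    ∃ a b c : ℂ, a + b + c = s₁ ∧ a * b + b * c + c * a = s₂ ∧ a * b * c = s₃ := by
  obtain ⟨a, ha⟩ := IsAlgClosed.exists_root
    (X ^ 3 - C s₁ * X ^ 2 + C s₂ * X - C s₃ : ℂ[X]) (by
      have : (X ^ 3 - C s₁ * X ^ 2 + C s₂ * X - C s₃ : ℂ[X]).degree = 3 := by compute_degree!
      rw [this]; norm_num)
  simp only [IsRoot, eval_sub, eval_add, eval_mul, eval_pow, eval_X, eval_C] at ha
  obtain ⟨b, c, h₁, h₂⟩ := exists_add_eq_mul_eq (s₁ - a) (s₂ - a * (s₁ - a))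
  exact ⟨a, b, c, by linear_combination h₁, by linear_combination h₂ + a * h₁,
    by linear_combination a * h₂ + ha⟩

/-- The value at a tangent line of the unit circle of the dual conic of the ellipse with foci
`f`, `g` which is inscribed in a Poncelet triangle. -/
theorem dualConic_diag (f g a : ℂ) (ha : ‖a‖ = 1) :
    ((a + a) ^ 2 - ((f + g) + conj (f + g) * (a * a)) * (a + a) + f * g
        + ((f + g) * conj (f + g) - 1 - f * g * conj (f * g)) * (a * a)
        + conj (f * g) * (a * a) ^ 2) * conj a ^ 2
      = ((‖a - f‖ ^ 2 * ‖a - g‖ ^ 2 + (1 - ‖f‖ ^ 2) * ‖a - g‖ ^ 2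
          + (1 - ‖g‖ ^ 2) * ‖a - f‖ ^ 2 : ℝ) : ℂ) := by
  have h : a * conj a = 1 := mul_conj_of_norm_eq_one ha
  have e (z : ℂ) : ((‖z‖ : ℂ)) ^ 2 = z * conj z := (Complex.mul_conj' z).symm
  push_cast
  rw [e, e, e, e]
  simp only [map_sub, map_add, map_mul]
  generalize conj a = a' at *
  have ha0 : a ≠ 0 := left_ne_zero_of_mul_eq_one h
  obtain rfl : a' = a⁻¹ := by field_simp; linear_combination h
  field_simp
  ring

theorem dualConic_diag_pos {f g a : ℂ} (hf : ‖f‖ < 1) (hg : ‖g‖ < 1) (ha : ‖a‖ = 1) :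
    0 < ‖a - f‖ ^ 2 * ‖a - g‖ ^ 2 + (1 - ‖f‖ ^ 2) * ‖a - g‖ ^ 2 + (1 - ‖g‖ ^ 2) * ‖a - f‖ ^ 2 := by
  have h1 : 0 < ‖a - f‖ := norm_pos_iff.2 (sub_ne_zero.2 (by rintro rfl; linarith))
  have h2 : 0 < 1 - ‖g‖ ^ 2 := by nlinarith [norm_nonneg g]
  have h3 : 0 < 1 - ‖f‖ ^ 2 := by nlinarith [norm_nonneg f]
  positivity

theorem dualConic_diag_nonpos {f g : ℂ} (hf : 1 ≤ ‖f‖) (hg : 1 ≤ ‖g‖) :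
    ∃ a : ℂ, ‖a‖ = 1 ∧ ‖a - f‖ ^ 2 * ‖a - g‖ ^ 2 + (1 - ‖f‖ ^ 2) * ‖a - g‖ ^ 2
      + (1 - ‖g‖ ^ 2) * ‖a - f‖ ^ 2 ≤ 0 := by
  have hf0 : (‖f‖ : ℂ) ≠ 0 := by exact_mod_cast (by linarith : ‖f‖ ≠ 0)
  -- At the point of the circle nearest to `f` one has `‖a - f‖ = ‖f‖ - 1`, so the first two terms
  -- add up to `-2 (‖f‖ - 1) ‖a - g‖²`.
  refine ⟨f / ‖f‖, ?_, ?_⟩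
  · rw [norm_div, Complex.norm_real, norm_norm, div_self (by linarith)]
  · have h : ‖f / (‖f‖ : ℂ) - f‖ = ‖f‖ - 1 := by
      have : f / (‖f‖ : ℂ) - f = -((f / ‖f‖) * ((‖f‖ - 1 : ℝ) : ℂ)) := by
        push_cast; field_simp; ring
      rw [this, norm_neg, norm_mul, norm_div, Complex.norm_real, Complex.norm_real, norm_norm,
        div_self (by linarith), one_mul, Real.norm_of_nonneg (by linarith)]
    rw [h]
    have h1 := mul_nonneg (sq_nonneg ‖f / (‖f‖ : ℂ) - g‖) (sub_nonneg.2 hf)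
    have h2 : 0 ≤ (‖g‖ ^ 2 - 1) * (‖f‖ - 1) ^ 2 := mul_nonneg (by nlinarith) (sq_nonneg _)
    nlinarith

/-- `a`, `b`, `c` are distinct points of the unit circle which the cubic Blaschke product with
zeros at `0` and at the roots of `z² - m z + n` maps to `a b c`. -/
structure IsBlaschkeTriple (m n a b c : ℂ) : Prop where
  norm_a : ‖a‖ = 1
  norm_b : ‖b‖ = 1
  norm_c : ‖c‖ = 1
  a_ne_b : a ≠ b
  b_ne_c : b ≠ c
  c_ne_a : c ≠ a
  sum : a + b + c = m + a * b * c * conj n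
  sum_mul : a * b + b * c + c * a = n + a * b * c * conj m

/-- A double root would make the tangent to the circle at `a` a zero of the dual conic, whose value
there is strictly positive by `dualConic_diag_pos`. -/
theorem ne_of_cubic {f g a b c : ℂ} (hf : ‖f‖ < 1) (hg : ‖g‖ < 1) (ha : ‖a‖ = 1)
    (h₁ : a + b + c = f + g + a * b * c * conj (f * g))
    (h₂ : a * b + b * c + c * a = f * g + a * b * c * conj (f + g)) : a ≠ b := by
  rintro rfl
  have h := dualConic_diag f g a ha
  have hp := dualConic_diag_pos hf hg ha
  have h0 : (a + a) ^ 2 - ((f + g) + conj (f + g) * (a * a)) * (a + a) + f * g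
        + ((f + g) * conj (f + g) - 1 - f * g * conj (f * g)) * (a * a)
        + conj (f * g) * (a * a) ^ 2 = 0 := by
    linear_combination ((a+a) - conj (f+g) * (a*a)) * h₁ - (1 - conj (f*g) * (a*a)) * h₂
  rw [h0, zero_mul] at h
  rw [← Complex.ofReal_zero, Complex.ofReal_inj] at h
  linarith

/-- Off the unit circle every Blaschke factor has modulus on the same side of `1` as `‖z‖`, so the
two sides of the cubic cannot have equal norms. -/
theorem norm_eq_one_of_cubic {f g z l : ℂ} (hf : ‖f‖ < 1) (hg : ‖g‖ < 1) (hl : ‖l‖ = 1)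
    (h : z * ((z - f) * (z - g)) = l * ((1 - conj f * z) * (1 - conj g * z))) : ‖z‖ = 1 := by
  have h' := congrArg norm h
  simp only [norm_mul, hl, one_mul] at h'
  rcases lt_trichotomy ‖z‖ 1 with hz | hz | hz
  · have h1 := norm_sub_lt_of_norm_lt_one hf hz
    have h2 := norm_sub_lt_of_norm_lt_one hg hz
    have h3 := mul_lt_mul'' h1 h2 (norm_nonneg _) (norm_nonneg _)
    nlinarith [norm_nonneg z, mul_nonneg (norm_nonneg (z - f)) (norm_nonneg (z - g))]
  · exact hz
  · have h1 := lt_norm_sub_of_one_lt_norm hf hz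
    have h2 := lt_norm_sub_of_one_lt_norm hg hz
    have h3 := mul_lt_mul'' h1 h2 (norm_nonneg _) (norm_nonneg _)
    nlinarith [norm_nonneg z, mul_nonneg (norm_nonneg (z - f)) (norm_nonneg (z - g))]

/-- This makes every unimodular `l` the parameter of a triangle, so the locus is the image of the
whole circle and not just of a part of it. -/
theorem exists_isBlaschkeTriple {f g l : ℂ} (hf : ‖f‖ < 1) (hg : ‖g‖ < 1) (hl : ‖l‖ = 1) :
    ∃ a b c, IsBlaschkeTriple (f + g) (f * g) a b c ∧ a * b * c = l := by
  obtain ⟨a, b, c, h₁, h₂, h₃⟩ := exists_cubic_roots (f + g + l * conj (f * g))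
    (f * g + l * conj (f + g)) l
  have key (z : ℂ) (hz : (z - a) * (z - b) * (z - c) = 0) : ‖z‖ = 1 := by
    refine norm_eq_one_of_cubic hf hg hl ?_
    simp only [map_add, map_mul] at h₁ h₂
    linear_combination hz + z ^ 2 * h₁ - z * h₂ + h₃
  subst h₃
  have ha := key a (by ring)
  have hb := key b (by ring)
  have hc := key c (by ring)
  exact ⟨a, b, c, ⟨ha, hb, hc, ne_of_cubic hf hg ha h₁ h₂,
    ne_of_cubic (c := a) hf hg hb (by linear_combination h₁) (by linear_combination h₂),
    ne_of_cubic (c := b) hf hg hc (by linear_combination h₁) (by linear_combination h₂), h₁, h₂⟩, rfl⟩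

/-! ### Intersections of lines with ellipses -/

theorem mem_line_iff {A B Z : ℂ} : Z ∈ line[ℝ, A, B] ↔ ∃ t : ℝ, A + t * (B - A) = Z := by
  rw [mem_affineSpan_pair_iff_exists_lineMap_eq]
  simp [AffineMap.lineMap_apply, add_comm]

/-- The polynomial is Heron's product for lengths `s`, `dist z F`, `dist z G`; the triangle
inequality and `dist F G < s` leave only the factor `dist z F + dist z G - s`. -/
theorem mem_ellipse_iff {F G z : ℂ} {s : ℝ} (h : dist F G < s) :
    z ∈ ellipse F G s ↔
      4 * s ^ 2 * ‖z - G‖ ^ 2 - (s ^ 2 + ‖z - G‖ ^ 2 - ‖z - F‖ ^ 2) ^ 2 = 0 := by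
  have h1 := dist_triangle_left F G z
  have h2 := dist_triangle z F G
  have h3 := dist_triangle_right F z G
  have h4 := dist_triangle z G F
  rw [dist_comm G F] at h4
  have h5 : 0 ≤ dist z F := dist_nonneg
  have h6 : 0 ≤ dist z G := dist_nonneg
  have h7 : 0 ≤ dist F G := dist_nonneg
  change dist z F + dist z G = s ↔ _
  rw [← dist_eq_norm, ← dist_eq_norm]
  generalize dist z F = x at *
  generalize dist z G = y at *
  constructor
  · rintro rfl; ring
  · intro h8
    have h9 : (s + y + x) * (s + y - x) * (x + s - y) * (x + y - s) = 0 := by linear_combination h8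
    rcases mul_eq_zero.1 h9 with h9 | h9
    · rcases mul_eq_zero.1 h9 with h9 | h9
      · rcases mul_eq_zero.1 h9 with h9 | h9 <;> linarith
      · linarith
    · linarith

theorem existsUnique_quadratic_iff {α β γ : ℝ} (hα : 0 < α) :
    (∃! t : ℝ, α * t ^ 2 + β * t + γ = 0) ↔ β ^ 2 - 4 * α * γ = 0 := by
  constructor
  · rintro ⟨t, ht, hu⟩
    have h : -β / α - t = t := hu _ (by field_simp; linear_combination α * ht)
    have h' : β = -2 * α * t := by field_simp at h; linarith
    subst h'
    linear_combination -4 * α * ht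
  · intro h
    refine ⟨-β / (2 * α), by field_simp; linear_combination (-1) * h, fun t ht => ?_⟩
    have h2 : (2 * α * t + β) ^ 2 = 0 := by linear_combination h + 4 * α * ht
    have h3 := pow_eq_zero_iff (two_ne_zero) |>.1 h2
    field_simp
    linarith

theorem discrim_neg_of_forall_ne {α β γ : ℝ} (hα : 0 < α)
    (h : ∀ t : ℝ, α * t ^ 2 + β * t + γ ≠ 0) : β ^ 2 - 4 * α * γ < 0 := by
  by_contra! h0
  obtain ⟨d, hd⟩ : ∃ d, d ^ 2 = β ^ 2 - 4 * α * γ := ⟨_, Real.sq_sqrt h0⟩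
  refine h ((-β + d) / (2 * α)) ?_
  field_simp
  linear_combination hd

/-- The quadratic equation satisfied by the intersections of the ellipse with foci `G₁`, `G₂` and
major axis `r` with the line `t ↦ A + t D`; the discriminant is positive, zero or negative
according to the product of the signed distances of the foci from the line. -/
theorem exists_quadratic_of_line {G₁ G₂ : ℂ} {r : ℝ} (h : dist G₁ G₂ < r) (A : ℂ) {D : ℂ}
    (hD : D ≠ 0) : ∃ α β γ : ℝ, 0 < α ∧
      (∀ t : ℝ, A + t * D ∈ ellipse G₁ G₂ r ↔ α * t ^ 2 + β * t + γ = 0) ∧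
      β ^ 2 - 4 * α * γ = -16 * r ^ 2 * (r ^ 2 - ‖G₁ - G₂‖ ^ 2) *
        (4 * ((G₁ - A) * conj D).im * ((G₂ - A) * conj D).im
          - (r ^ 2 - ‖G₁ - G₂‖ ^ 2) * ‖D‖ ^ 2) := by
  have hr : ‖G₁ - G₂‖ < r := by rwa [← dist_eq_norm]
  have hr2 : ‖G₁ - G₂‖ ^ 2 < r ^ 2 := by nlinarith [norm_nonneg (G₁ - G₂)]
  have hd : 0 < D.re ^ 2 + D.im ^ 2 := by
    have := Complex.normSq_pos.2 hD
    rw [Complex.normSq_apply] at this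
    nlinarith
  obtain ⟨u, hu⟩ : ∃ u, u = G₁ - A := ⟨_, rfl⟩
  obtain ⟨v, hv⟩ : ∃ v, v = G₂ - A := ⟨_, rfl⟩
  have h1 : G₁ - G₂ = u - v := by rw [hu, hv]; ring
  have h2 (t : ℝ) : A + t * D - G₁ = t * D - u := by rw [hu]; ring
  have h3 (t : ℝ) : A + t * D - G₂ = t * D - v := by rw [hv]; ring
  refine ⟨4 * r ^ 2 * (D.re ^ 2 + D.im ^ 2)
      - (2 * (D.re * (u.re - v.re) + D.im * (u.im - v.im))) ^ 2,
    -8 * r ^ 2 * (D.re * v.re + D.im * v.im)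
      - 2 * (r ^ 2 + v.re ^ 2 + v.im ^ 2 - u.re ^ 2 - u.im ^ 2)
        * (2 * (D.re * (u.re - v.re) + D.im * (u.im - v.im))),
    4 * r ^ 2 * (v.re ^ 2 + v.im ^ 2)
      - (r ^ 2 + v.re ^ 2 + v.im ^ 2 - u.re ^ 2 - u.im ^ 2) ^ 2, ?_, ?_, ?_⟩
  · rw [h1, ← Complex.normSq_eq_norm_sq, Complex.normSq_apply] at hr2
    simp only [Complex.sub_re, Complex.sub_im] at hr2
    -- Positivity of the leading coefficient is Cauchy–Schwarz for `D` and `G₁ - G₂`, together with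
    -- `‖G₁ - G₂‖ < r`.
    have := mul_pos (sub_pos.2 hr2) hd
    nlinarith [sq_nonneg (D.re * (u.im - v.im) - D.im * (u.re - v.re))]
  · intro t
    rw [mem_ellipse_iff h, h2, h3]
    simp only [← Complex.normSq_eq_norm_sq, Complex.normSq_apply]
    simp only [Complex.sub_re, Complex.sub_im, Complex.re_ofReal_mul, Complex.im_ofReal_mul]
    constructor <;> intro h0 <;> linear_combination h0
  · rw [h1, ← hu, ← hv]
    simp only [← Complex.normSq_eq_norm_sq, Complex.normSq_apply, Complex.mul_im, Complex.conj_re,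
      Complex.conj_im, Complex.sub_re, Complex.sub_im]
    ring

/-- The classical criterion: the product of the signed distances from the foci equals the squared
semi-minor axis. Since the restricted equation is genuinely quadratic, meeting in one point means
zero discriminant. -/
theorem isTangentLine_iff {G₁ G₂ : ℂ} {r : ℝ} (h : dist G₁ G₂ < r) {A B : ℂ} (hAB : A ≠ B) :
    IsTangentLine (ellipse G₁ G₂ r) A B ↔
      4 * ((G₁ - A) * conj (B - A)).im * ((G₂ - A) * conj (B - A)).im
          - (r ^ 2 - ‖G₁ - G₂‖ ^ 2) * ‖B - A‖ ^ 2 = 0 := by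
  have hD : B - A ≠ 0 := sub_ne_zero.2 hAB.symm
  obtain ⟨α, β, γ, hα, hmem, hdisc⟩ := exists_quadratic_of_line h A hD
  have hr0 : 0 < r := dist_nonneg.trans_lt h
  have hr : ‖G₁ - G₂‖ < r := by rwa [← dist_eq_norm]
  have hr2 : r ^ 2 - ‖G₁ - G₂‖ ^ 2 ≠ 0 := by nlinarith [norm_nonneg (G₁ - G₂)]
  have h1 : IsTangentLine (ellipse G₁ G₂ r) A B ↔ ∃! t : ℝ, α * t ^ 2 + β * t + γ = 0 := by
    simp only [IsTangentLine, mem_line_iff]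
    constructor
    · rintro ⟨Z, ⟨⟨t, rfl⟩, ht⟩, hu⟩
      refine ⟨t, (hmem t).1 ht, fun t' ht' => ?_⟩
      have h2 := hu (A + t' * (B - A)) ⟨⟨t', rfl⟩, (hmem t').2 ht'⟩
      exact_mod_cast mul_right_cancel₀ hD (add_left_cancel h2)
    · rintro ⟨t, ht, hu⟩
      refine ⟨A + t * (B - A), ⟨⟨t, rfl⟩, (hmem t).2 ht⟩, ?_⟩
      rintro _ ⟨⟨t', rfl⟩, ht'⟩
      rw [hu t' ((hmem t').1 ht')]
  rw [h1, existsUnique_quadratic_iff hα, hdisc]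
  simp [hr2, hr0.ne']

theorem pos_of_line_disjoint_ellipse {G₁ G₂ : ℂ} {r : ℝ} (h : dist G₁ G₂ < r) {A D : ℂ}
    (hD : D ≠ 0) (hdisj : ∀ t : ℝ, A + t * D ∉ ellipse G₁ G₂ r) :
    0 < 4 * ((G₁ - A) * conj D).im * ((G₂ - A) * conj D).im
          - (r ^ 2 - ‖G₁ - G₂‖ ^ 2) * ‖D‖ ^ 2 := by
  obtain ⟨α, β, γ, hα, hmem, hdisc⟩ := exists_quadratic_of_line h A hD
  have hr : ‖G₁ - G₂‖ < r := by rwa [← dist_eq_norm]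
  have h1 := discrim_neg_of_forall_ne hα (fun t ht => hdisj t ((hmem t).2 ht))
  rw [hdisc] at h1
  have h2 : 0 ≤ 16 * r ^ 2 * (r ^ 2 - ‖G₁ - G₂‖ ^ 2) := by
    have : 0 ≤ r ^ 2 - ‖G₁ - G₂‖ ^ 2 := by nlinarith [norm_nonneg (G₁ - G₂)]
    positivity
  by_contra! h3
  nlinarith [mul_nonneg h2 (neg_nonneg.2 h3)]

/-! ### Affine images of the unit circle -/

/-- The sum of distances to the foci is convex along the line through `0` and `z`. It equals `s` at
both unit points `±z/‖z‖`, so it cannot drop below `s` at `z`, beyond one of them. -/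
theorem notMem_ellipseInterior_of_one_le_norm {𝒜 : ℂ ≃ᵃ[ℝ] ℂ} {F G : ℂ} {s : ℝ}
    (h : 𝒜 '' Metric.sphere (0 : ℂ) 1 = ellipse F G s) {z : ℂ} (hz : 1 ≤ ‖z‖) :
    𝒜 z ∉ ellipseInterior F G s := by
  intro hlt
  have hlt : dist (𝒜 z) F + dist (𝒜 z) G < s := hlt
  have hz0 : (‖z‖ : ℂ) ≠ 0 := by exact_mod_cast (by linarith : ‖z‖ ≠ 0)
  have hu : ‖z / ‖z‖‖ = 1 := by
    rw [norm_div, Complex.norm_real, norm_norm, div_self (by linarith)]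
  have h1 : 𝒜 (z / ‖z‖) ∈ ellipse F G s := by
    rw [← h]; exact ⟨_, by simpa using hu, rfl⟩
  have h2 : 𝒜 (-(z / ‖z‖)) ∈ ellipse F G s := by
    rw [← h]; exact ⟨_, by rw [mem_sphere_zero_iff_norm, norm_neg, hu], rfl⟩
  have h1 : dist (𝒜 (z / ‖z‖)) F + dist (𝒜 (z / ‖z‖)) G = s := h1
  have h2 : dist (𝒜 (-(z / ‖z‖))) F + dist (𝒜 (-(z / ‖z‖))) G = s := h2
  have hconv : ConvexOn ℝ Set.univ (fun y : ℂ => dist y F + dist y G) :=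
    (convexOn_univ_dist F).add (convexOn_univ_dist G)
  -- The ratio in which `z/‖z‖` divides the segment from `-z/‖z‖` to `z`.
  set a : ℝ := 2 / (‖z‖ + 1) with ha
  have ha0 : 0 < a := by positivity
  have ha1 : a ≤ 1 := by rw [ha, div_le_one (by positivity)]; linarith
  have hc : z / ‖z‖ = AffineMap.lineMap (-(z / ‖z‖)) z a := by
    have : ((‖z‖ : ℂ) + 1) ≠ 0 := by exact_mod_cast (by positivity : ‖z‖ + 1 ≠ 0)
    simp only [AffineMap.lineMap_apply, ha, vsub_eq_sub, vadd_eq_add, Complex.real_smul]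
    push_cast
    field_simp
    ring
  have hc' : 𝒜 (z / ‖z‖) = (1 - a) • 𝒜 (-(z / ‖z‖)) + a • 𝒜 z := by
    rw [hc, ← AffineMap.lineMap_apply_module, ← hc]
    conv_lhs => rw [hc]
    exact (𝒜 : ℂ →ᵃ[ℝ] ℂ).apply_lineMap _ _ _
  have h3 := hconv.2 (Set.mem_univ (𝒜 (-(z / ‖z‖)))) (Set.mem_univ (𝒜 z))
    (sub_nonneg.2 ha1) ha0.le (by ring)
  rw [← hc'] at h3
  simp only [smul_eq_mul] at h3
  rw [h1, h2] at h3
  nlinarith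

theorem exists_affineEquiv_formula (𝒜 : ℂ ≃ᵃ[ℝ] ℂ) :
    ∃ p q c : ℂ, (∀ z, 𝒜 z = p * z + q * conj z + c) ∧ ‖p‖ ≠ ‖q‖ := by
  obtain ⟨p, q, hL⟩ : ∃ p q : ℂ, ∀ z, 𝒜.linear z = p * z + q * conj z := by
    refine ⟨(𝒜.linear 1 - Complex.I * 𝒜.linear Complex.I) / 2,
      (𝒜.linear 1 + Complex.I * 𝒜.linear Complex.I) / 2, fun z => ?_⟩
    have : z = z.re • (1 : ℂ) + z.im • Complex.I := by
      simp [Complex.re_add_im]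
    conv_lhs => rw [this, map_add, map_smul, map_smul]
    simp only [Complex.real_smul]
    apply Complex.ext <;> simp <;> ring
  have h0 (z) : 𝒜 z = p * z + q * conj z + 𝒜 0 := by
    have := 𝒜.map_vadd 0 z
    simp only [vadd_eq_add, add_zero, hL] at this
    exact this
  refine ⟨p, q, 𝒜 0, h0, fun hpq => ?_⟩
  obtain ⟨z, hz, hz0⟩ : ∃ z : ℂ, z ≠ 0 ∧ p * z + q * conj z = 0 := by
    by_cases hp : p = 0
    · have hq : q = 0 := by rw [hp, norm_zero] at hpq; exact norm_eq_zero.1 hpq.symm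
      exact ⟨1, one_ne_zero, by simp [hp, hq]⟩
    -- If `‖p‖ = ‖q‖`, a square root `z` of `-q/p` is unimodular, hence `p z = -q z̄` and the linear
    -- part has a kernel.
    · obtain ⟨z, hz⟩ := IsAlgClosed.exists_pow_nat_eq (-q / p) (n := 2) (by norm_num)
      have hn : ‖z‖ = 1 := by
        have := congrArg norm hz
        rw [norm_pow, norm_div, norm_neg, hpq, div_self (by rw [← hpq]; simpa using hp)] at this
        exact (pow_eq_one_iff_of_nonneg (norm_nonneg z) two_ne_zero).1 this
      have hzz : z * conj z = 1 := mul_conj_of_norm_eq_one hn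
      refine ⟨z, by rintro rfl; simp at hn, ?_⟩
      field_simp at hz
      linear_combination conj z * hz - p * z * hzz
  exact hz (𝒜.injective (by rw [h0 z, hz0, zero_add]))

theorem eq_zero_of_affine_eq_zero {p q z : ℂ} (hpq : ‖p‖ ≠ ‖q‖) (hz : p * z + q * conj z = 0) :
    z = 0 := by
  by_contra h0
  have h1 := congrArg norm (eq_neg_of_add_eq_zero_left hz)
  rw [norm_neg, norm_mul, norm_mul, RCLike.norm_conj] at h1
  exact hpq (mul_right_cancel₀ (norm_ne_zero_iff.2 h0) h1)

theorem exists_affineEquiv_of_norm_ne {p q : ℂ} (h : ‖p‖ ≠ ‖q‖) (c : ℂ) :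
    ∃ 𝒜 : ℂ ≃ᵃ[ℝ] ℂ, ∀ z, 𝒜 z = p * z + q * conj z + c := by
  let L : ℂ →ₗ[ℝ] ℂ :=
    { toFun := fun z => p * z + q * conj z
      map_add' := fun x y => by simp only [map_add]; ring
      map_smul' := fun t x => by
        simp only [Complex.real_smul, map_mul, Complex.conj_ofReal, RingHom.id_apply]; ring }
  have hL : Function.Injective L := by
    rw [← LinearMap.ker_eq_bot, LinearMap.ker_eq_bot']
    exact fun z hz => eq_zero_of_affine_eq_zero h hz
  refine ⟨(LinearEquiv.ofInjectiveEndo L hL).toAffineEquiv.trans (AffineEquiv.constVAdd ℝ ℂ c),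
    fun z => ?_⟩
  change c + (p * z + q * conj z) = _
  ring

/-- With semi-axes `a ≥ b`, major direction `u` and centre `c`, the map `x + iy ↦ c + u (a x + i b
y)` has `p = u (a + b)/2` and `q = u (a - b)/2`; thus `q` vanishes only for a circle. -/
theorem exists_affineEquiv_image_sphere {F₁ F₂ : ℂ} {s : ℝ} (h : dist F₁ F₂ < s) :
    ∃ (𝒜 : ℂ ≃ᵃ[ℝ] ℂ) (p q c : ℂ), 𝒜 '' Metric.sphere (0 : ℂ) 1 = ellipse F₁ F₂ s ∧
      (∀ z, 𝒜 z = p * z + q * conj z + c) ∧ ‖p‖ ≠ ‖q‖ ∧ p ≠ 0 ∧ (F₁ ≠ F₂ → q ≠ 0) := by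
  obtain ⟨u, hu, hF⟩ : ∃ u : ℂ, ‖u‖ = 1 ∧ F₁ - F₂ = ‖F₁ - F₂‖ * u := by
    by_cases h0 : F₁ - F₂ = 0
    · exact ⟨1, by simp, by simp [h0]⟩
    · have h1 : (‖F₁ - F₂‖ : ℂ) ≠ 0 := by simpa using h0
      refine ⟨(F₁ - F₂) / ‖F₁ - F₂‖, ?_, by field_simp⟩
      rw [norm_div, Complex.norm_real, norm_norm, div_self (by simpa using h0)]
  rw [dist_eq_norm] at h
  obtain ⟨η, hη⟩ : ∃ η, η = ‖F₁ - F₂‖ / 2 := ⟨_, rfl⟩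
  obtain ⟨a, ha⟩ : ∃ a, a = s / 2 := ⟨_, rfl⟩
  have hη0 : 0 ≤ η := by rw [hη]; positivity
  have hηa : η < a := by rw [hη, ha]; linarith
  obtain ⟨b, hb⟩ : ∃ b, b = √(a ^ 2 - η ^ 2) := ⟨_, rfl⟩
  have hb2 : b ^ 2 = a ^ 2 - η ^ 2 := by rw [hb]; exact Real.sq_sqrt (by nlinarith)
  have hb0 : 0 < b := by rw [hb]; exact Real.sqrt_pos.2 (by nlinarith)
  have hu0 : u ≠ 0 := by rintro rfl; simp at hu
  have hpn : ‖((a + b) / 2 : ℝ) * u‖ = (a + b) / 2 := by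
    rw [norm_mul, hu, mul_one, Complex.norm_real, Real.norm_of_nonneg (by linarith)]
  have hab : b ≤ a := by nlinarith
  have hqn : ‖((a - b) / 2 : ℝ) * u‖ = (a - b) / 2 := by
    rw [norm_mul, hu, mul_one, Complex.norm_real, Real.norm_of_nonneg (by linarith)]
  obtain ⟨c, hc⟩ : ∃ c, c = (F₁ + F₂) / 2 := ⟨_, rfl⟩
  have hpq : ‖((a + b) / 2 : ℝ) * u‖ ≠ ‖((a - b) / 2 : ℝ) * u‖ := by rw [hpn, hqn]; linarith
  obtain ⟨𝒜, h𝒜⟩ := exists_affineEquiv_of_norm_ne hpq c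
  have hF1 : F₁ = c + η * u := by rw [hc, hη]; push_cast; linear_combination hF / 2
  have hF2 : F₂ = c - η * u := by rw [hc, hη]; push_cast; linear_combination -hF / 2
  have hmem (z : ℂ) : 𝒜 z ∈ ellipse F₁ F₂ s ↔ ‖z‖ = 1 := by
    rw [mem_ellipse_iff (by rwa [dist_eq_norm])]
    have e1 : 𝒜 z - F₁ = u * ⟨a * z.re - η, b * z.im⟩ := by
      rw [h𝒜, hF1]
      have : (⟨a * z.re - η, b * z.im⟩ : ℂ) = ((a + b) / 2 : ℝ) * z + ((a - b) / 2 : ℝ) * conj z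
          - η := by
        apply Complex.ext <;> simp <;> ring
      rw [this]; ring
    have e2 : 𝒜 z - F₂ = u * ⟨a * z.re + η, b * z.im⟩ := by
      rw [h𝒜, hF2]
      have : (⟨a * z.re + η, b * z.im⟩ : ℂ) = ((a + b) / 2 : ℝ) * z + ((a - b) / 2 : ℝ) * conj z
          + η := by
        apply Complex.ext <;> simp <;> ring
      rw [this]; ring
    have hs : s = 2 * a := by rw [ha]; ring
    rw [e1, e2, norm_mul, norm_mul, hu, one_mul, one_mul, hs]
    rw [← pow_eq_one_iff_of_nonneg (norm_nonneg z) two_ne_zero]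
    simp only [← Complex.normSq_eq_norm_sq, Complex.normSq_apply]
    have hab2 : (16 * a ^ 2 * (a ^ 2 - η ^ 2)) ≠ 0 := by
      have : 0 < a := by linarith
      rw [← hb2]; positivity
    constructor
    · intro h0
      apply mul_left_cancel₀ hab2
      linear_combination h0 - 16 * a ^ 2 * z.im ^ 2 * hb2
    · intro h0
      linear_combination (16 * a ^ 2 * (a ^ 2 - η ^ 2)) * h0 + 16 * a ^ 2 * z.im ^ 2 * hb2
  refine ⟨𝒜, _, _, c, ?_, h𝒜, hpq, ?_, ?_⟩
  · ext x
    constructor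
    · rintro ⟨z, hz, rfl⟩
      exact (hmem z).2 (by simpa using hz)
    · intro hx
      exact ⟨𝒜.symm x, by simpa using (hmem (𝒜.symm x)).1 (by simpa using hx), by simp⟩
  · rw [← norm_pos_iff, hpn]; linarith
  · intro hne
    have : 0 < η := by
      rw [hη]
      have := norm_pos_iff.2 (sub_ne_zero.2 hne)
      linarith
    rw [← norm_pos_iff, hqn]
    nlinarith

/-! ### Dual conics and Poncelet closure -/

/-- The dual conic, in terms of the chords of the unit circle: the chord `ab` is the line
`z + a b z̄ = a + b`. -/
theorem dualConic_eq_zero {m n m' n' a b c : ℂ} (h₁ : a + b + c = m + a * b * c * n')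
    (h₂ : a * b + b * c + c * a = n + a * b * c * m') :
    (a + b) ^ 2 - (m + m' * (a * b)) * (a + b) + n + (m * m' - 1 - n * n') * (a * b)
      + n' * (a * b) ^ 2 = 0 := by
  linear_combination ((a + b) - m' * (a * b)) * h₁ - (1 - n' * (a * b)) * h₂

/-- For fixed `a` the tangency condition is a quadratic in the other end of the chord, with roots
`b` and `c`. The first conclusion is Vieta for their sum; the second amounts to Vieta for their
product. -/
theorem cubic_of_dualConic {m n m' n' k a b c : ℂ} (hbc : b ≠ c)
    (hb : (a + b) ^ 2 - (m + m' * (a * b)) * (a + b) + n + k * (a * b) + n' * (a * b) ^ 2 = 0)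
    (hc : (a + c) ^ 2 - (m + m' * (a * c)) * (a + c) + n + k * (a * c) + n' * (a * c) ^ 2 = 0) :
    (1 - m' * a + n' * a ^ 2) * (b + c) + (2 * a - m - m' * a ^ 2 + k * a) = 0 ∧
      a ^ 3 - (m + a * b * c * n') * a ^ 2 + (n + a * b * c * m') * a - a * b * c = 0 := by
  have h : (1 - m' * a + n' * a ^ 2) * (b + c) + (2 * a - m - m' * a ^ 2 + k * a) = 0 := by
    apply mul_left_cancel₀ (sub_ne_zero.2 hbc)
    linear_combination hb - hc
  exact ⟨h, by linear_combination a * hb - a * b * h⟩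

theorem vieta_of_cubic {s t l a b c : ℂ} (hab : a ≠ b) (hbc : b ≠ c) (hca : c ≠ a)
    (ha : a ^ 3 - s * a ^ 2 + t * a - l = 0) (hb : b ^ 3 - s * b ^ 2 + t * b - l = 0)
    (hc : c ^ 3 - s * c ^ 2 + t * c - l = 0) :
    a + b + c = s ∧ a * b + b * c + c * a = t := by
  have h1 : a ^ 2 + a * b + b ^ 2 - s * (a + b) + t = 0 := by
    apply mul_left_cancel₀ (sub_ne_zero.2 hab); linear_combination ha - hb
  have h2 : b ^ 2 + b * c + c ^ 2 - s * (b + c) + t = 0 := by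
    apply mul_left_cancel₀ (sub_ne_zero.2 hbc); linear_combination hb - hc
  have h3 : a + b + c = s := by
    apply mul_left_cancel₀ (sub_ne_zero.2 hca); linear_combination h2 - h1
  exact ⟨h3, by linear_combination (a + b) * h3 - h1⟩

/-- The closure condition of Poncelet's porism for triangles. -/
theorem vieta_of_dualConic {m n m' n' k a b c : ℂ} (ha0 : a ≠ 0)
    (hab : a ≠ b) (hbc : b ≠ c) (hca : c ≠ a)
    (h₁ : (a + b) ^ 2 - (m + m' * (a * b)) * (a + b) + n + k * (a * b) + n' * (a * b) ^ 2 = 0)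
    (h₂ : (b + c) ^ 2 - (m + m' * (b * c)) * (b + c) + n + k * (b * c) + n' * (b * c) ^ 2 = 0)
    (h₃ : (c + a) ^ 2 - (m + m' * (c * a)) * (c + a) + n + k * (c * a) + n' * (c * a) ^ 2 = 0) :
    a + b + c = m + a * b * c * n' ∧ a * b + b * c + c * a = n + a * b * c * m' ∧
      k = m * m' - 1 - n * n' := by
  obtain ⟨ha, ha'⟩ := cubic_of_dualConic hbc h₁ (by linear_combination h₃)
  have hb' := (cubic_of_dualConic (a := b) (b := c) (c := a) hca h₂ (by linear_combination h₁)).2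
  have hc' := (cubic_of_dualConic (a := c) (b := a) (c := b) hab h₃ (by linear_combination h₂)).2
  obtain ⟨e1, e2⟩ := vieta_of_cubic hab hbc hca ha' (l := a * b * c)
    (by linear_combination hb') (by linear_combination hc')
  refine ⟨e1, e2, ?_⟩
  apply mul_left_cancel₀ ha0
  linear_combination ha - (1 - m' * a + n' * a ^ 2) * e1 + n' * ha'

theorem ofReal_im_mul_im (x y : ℂ) :
    ((4 * x.im * y.im : ℝ) : ℂ) = -((x - conj x) * (y - conj y)) := by
  rw [Complex.sub_conj, Complex.sub_conj]
  push_cast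
  linear_combination (4 * x.im * y.im : ℂ) * Complex.I_sq

/-- Translates metric tangency of the affine image into the chord equation `z + a b z̄ = a + b`
evaluated at the preimages `w₁, w₂` of the foci. The direction `d` is left free up to real scale, so
that the degenerate chord `a = b`, a tangent of the circle, is covered too. -/
theorem tangency_eq_dualConic {p q c w₁ w₂ a b d : ℂ} {κ : ℝ} (ha : ‖a‖ = 1) (hb : ‖b‖ = 1)
    (hd : conj d * (a * b) = -d) :
    ((4 * ((p * w₁ + q * conj w₁ + c - (p * a + q * conj a + c)) * conj (p * d + q * conj d)).im
        * ((p * w₂ + q * conj w₂ + c - (p * a + q * conj a + c)) * conj (p * d + q * conj d)).im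
        - κ * ‖p * d + q * conj d‖ ^ 2 : ℝ) : ℂ)
      = d * conj d * conj a * conj b *
        ((p * conj p - q * conj q) ^ 2 * (w₁ + a * b * conj w₁ - (a + b))
            * (w₂ + a * b * conj w₂ - (a + b))
          - κ * (p * (a * b) - q) * (conj p - conj q * (a * b))) := by
  have h1 : a * conj a = 1 := mul_conj_of_norm_eq_one ha
  have h2 : b * conj b = 1 := mul_conj_of_norm_eq_one hb
  have ha0 : a ≠ 0 := left_ne_zero_of_mul_eq_one h1
  have hb0 : b ≠ 0 := left_ne_zero_of_mul_eq_one h2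
  rw [Complex.ofReal_sub, ofReal_im_mul_im, Complex.ofReal_mul, Complex.ofReal_pow,
    ← Complex.mul_conj']
  simp only [map_sub, map_add, map_mul, Complex.conj_conj]
  have hd' : conj d = -d / (a * b) := by field_simp; linear_combination hd
  rw [hd']
  generalize conj a = a' at *
  generalize conj b = b' at *
  obtain rfl : a' = a⁻¹ := by field_simp; linear_combination h1
  obtain rfl : b' = b⁻¹ := by field_simp; linear_combination h2
  field_simp
  ring

theorem affineIndependent_of_norm_eq_one {a b c : ℂ} (ha : ‖a‖ = 1) (hb : ‖b‖ = 1) (hc : ‖c‖ = 1)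
    (hab : a ≠ b) (hbc : b ≠ c) (hca : c ≠ a) : AffineIndependent ℝ ![a, b, c] := by
  refine EuclideanGeometry.Cospherical.affineIndependent_of_ne
    (⟨0, 1, ?_⟩ : EuclideanGeometry.Cospherical ({a, b, c} : Set ℂ)) hab hca.symm hbc
  simp [ha, hb, hc]

/-- By the parallelogram law, `hell` becomes `(1 - ‖f‖²)(1 - ‖g‖²) > 0`, so `f` and `g` are both
inside or both outside the disc. If both were outside, `dualConic_diag_nonpos` would contradict
`hpos`. -/
theorem norm_lt_one_of_dualConic {m n : ℂ} {f g : ℂ} (hm : f + g = m) (hn : f * g = n) {k : ℝ}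
    (hk : (k : ℂ) = m * conj m - 1 - n * conj n)
    (hell : ‖m ^ 2 - 4 * n‖ < ‖m‖ ^ 2 - 2 * k)
    (hpos : ∀ a : ℂ, ‖a‖ = 1 → 0 < (((a + a) ^ 2 - (m + conj m * (a * a)) * (a + a) + n
        + k * (a * a) + conj n * (a * a) ^ 2) * conj a ^ 2).re) : ‖f‖ < 1 ∧ ‖g‖ < 1 := by
  subst hm hn
  have h1 : ‖(f + g) ^ 2 - 4 * (f * g)‖ = ‖f - g‖ ^ 2 := by
    rw [← norm_pow]; congr 1; ring
  have h2 : k = ‖f + g‖ ^ 2 - 1 - ‖f‖ ^ 2 * ‖g‖ ^ 2 := by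
    rw [Complex.mul_conj', Complex.mul_conj', norm_mul] at hk
    rw [← mul_pow]
    exact_mod_cast hk
  have h3 := parallelogram_law_with_norm ℝ f g
  have h4 : 0 < (1 - ‖f‖ ^ 2) * (1 - ‖g‖ ^ 2) := by
    rw [h1] at hell
    nlinarith
  have hlt (x : ℂ) : ‖x‖ < 1 ↔ 0 < 1 - ‖x‖ ^ 2 := by
    rw [sub_pos, sq_lt_one_iff₀ (norm_nonneg x)]
  rcases pos_and_pos_or_neg_and_neg_of_mul_pos h4 with h5 | ⟨h5, h6⟩
  · rwa [hlt, hlt]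
  · exfalso
    obtain ⟨a, ha, hle⟩ := dualConic_diag_nonpos (f := f) (g := g)
      (by by_contra! h; linarith [(hlt f).1 h]) (by by_contra! h; linarith [(hlt g).1 h])
    have h7 := hpos a ha
    rw [hk, dualConic_diag f g a ha, Complex.ofReal_re] at h7
    linarith

theorem exists_blaschke_of_poncelet {F₁ F₂ G₁ G₂ : ℂ} {s r : ℝ} (hK : dist G₁ G₂ < r)
    (hnested : ellipse G₁ G₂ r ⊆ ellipseInterior F₁ F₂ s)
    (hPoncelet : ∃ A B C : ℂ, IsPonceletTriangle (ellipse F₁ F₂ s) (ellipse G₁ G₂ r) A B C)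
    {𝒜 : ℂ ≃ᵃ[ℝ] ℂ} (h𝒜 : 𝒜 '' Metric.sphere (0 : ℂ) 1 = ellipse F₁ F₂ s)
    {p q c : ℂ} (hpq : ‖p‖ ≠ ‖q‖) (hform : ∀ z, 𝒜 z = p * z + q * conj z + c) :
    ∃ f g : ℂ, ‖f‖ < 1 ∧ ‖g‖ < 1 ∧
      (∀ x y z : ℂ, IsPonceletTriangle (ellipse F₁ F₂ s) (ellipse G₁ G₂ r) (𝒜 x) (𝒜 y) (𝒜 z) ↔
        IsBlaschkeTriple (f + g) (f * g) x y z) ∧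
      G₁ + G₂ = p * (f + g) + q * conj (f + g) + 2 * c ∧
      (G₁ - c) * (G₂ - c) = p ^ 2 * (f * g) + q ^ 2 * conj (f * g)
        + p * q * ((f + g) * conj (f + g) - 1 - f * g * conj (f * g)) := by
  obtain ⟨w₁, rfl⟩ := 𝒜.surjective G₁
  obtain ⟨w₂, rfl⟩ := 𝒜.surjective G₂
  have hmem (z : ℂ) : 𝒜 z ∈ ellipse F₁ F₂ s ↔ ‖z‖ = 1 := by
    rw [← h𝒜, 𝒜.injective.mem_set_image, mem_sphere_zero_iff_norm]
  obtain ⟨δ, hδ⟩ : ∃ δ : ℝ, δ = ‖p‖ ^ 2 - ‖q‖ ^ 2 := ⟨_, rfl⟩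
  have hδ0 : δ ≠ 0 := by
    rw [hδ, sub_ne_zero]
    exact fun h => hpq ((pow_left_inj₀ (norm_nonneg _) (norm_nonneg _) two_ne_zero).1 h)
  have hδC : (p * conj p - q * conj q : ℂ) = δ := by
    rw [Complex.mul_conj', Complex.mul_conj', hδ]; push_cast; rfl
  obtain ⟨κ, hκ⟩ : ∃ κ : ℝ, κ = (r ^ 2 - ‖𝒜 w₁ - 𝒜 w₂‖ ^ 2) / δ ^ 2 := ⟨_, rfl⟩
  have hκ0 : 0 < κ := by
    rw [hκ]
    have hr : ‖𝒜 w₁ - 𝒜 w₂‖ < r := by rwa [← dist_eq_norm]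
    have : 0 < r ^ 2 - ‖𝒜 w₁ - 𝒜 w₂‖ ^ 2 := by nlinarith [norm_nonneg (𝒜 w₁ - 𝒜 w₂)]
    positivity
  have hκ' : r ^ 2 - ‖𝒜 w₁ - 𝒜 w₂‖ ^ 2 = κ * δ ^ 2 := by rw [hκ]; field_simp
  -- `m`, `n`, `k` are read off by expanding the bracket of `tangency_eq_dualConic`, divided by
  -- `δ²`, in powers of `a + b` and `a b`.
  obtain ⟨m, hm⟩ : ∃ m, m = w₁ + w₂ := ⟨_, rfl⟩
  obtain ⟨n, hn⟩ : ∃ n, n = w₁ * w₂ + κ * q * conj p := ⟨_, rfl⟩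
  obtain ⟨k, hk⟩ : ∃ k : ℝ, k = 2 * (w₁ * conj w₂).re - κ * (‖p‖ ^ 2 + ‖q‖ ^ 2) := ⟨_, rfl⟩
  have hkC : (k : ℂ) = w₁ * conj w₂ + conj w₁ * w₂ - κ * (p * conj p + q * conj q) := by
    rw [hk]
    have := Complex.add_conj (w₁ * conj w₂)
    simp only [map_mul, Complex.conj_conj] at this
    rw [this, Complex.mul_conj', Complex.mul_conj']
    push_cast; ring
  have key {a b d : ℂ} (ha : ‖a‖ = 1) (hb : ‖b‖ = 1) (hd : conj d * (a * b) = -d) :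
      ((4 * ((𝒜 w₁ - 𝒜 a) * conj (p * d + q * conj d)).im
        * ((𝒜 w₂ - 𝒜 a) * conj (p * d + q * conj d)).im
        - (r ^ 2 - ‖𝒜 w₁ - 𝒜 w₂‖ ^ 2) * ‖p * d + q * conj d‖ ^ 2 : ℝ) : ℂ)
      = ‖d‖ ^ 2 * δ ^ 2 * (((a + b) ^ 2 - (m + conj m * (a * b)) * (a + b) + n
        + k * (a * b) + conj n * (a * b) ^ 2) * (conj a * conj b)) := by
    rw [hκ', hform w₁, hform w₂, hform a, tangency_eq_dualConic ha hb hd, hkC, hm, hn, hδC,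
      Complex.mul_conj']
    simp only [map_add, map_mul, Complex.conj_conj, Complex.conj_ofReal]
    push_cast
    ring
  have htan {a b : ℂ} (ha : ‖a‖ = 1) (hb : ‖b‖ = 1) (hab : a ≠ b) :
      IsTangentLine (ellipse (𝒜 w₁) (𝒜 w₂) r) (𝒜 a) (𝒜 b) ↔
        (a + b) ^ 2 - (m + conj m * (a * b)) * (a + b) + n
          + k * (a * b) + conj n * (a * b) ^ 2 = 0 := by
    rw [isTangentLine_iff hK (fun h => hab (𝒜.injective h))]
    have h1 : a * conj a = 1 := mul_conj_of_norm_eq_one ha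
    have h2 : b * conj b = 1 := mul_conj_of_norm_eq_one hb
    have hd : conj (b - a) * (a * b) = -(b - a) := by
      rw [map_sub]; linear_combination a * h2 - b * h1
    have hBA : 𝒜 b - 𝒜 a = p * (b - a) + q * conj (b - a) := by
      rw [hform, hform, map_sub]; ring
    rw [← Complex.ofReal_eq_zero, hBA, key ha hb hd]
    have hn0 : (‖b - a‖ : ℂ) ≠ 0 := by simpa [sub_eq_zero] using hab.symm
    have hδ0' : (δ : ℂ) ≠ 0 := by exact_mod_cast hδ0
    have ha0 := right_ne_zero_of_mul_eq_one h1
    have hb0 := right_ne_zero_of_mul_eq_one h2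
    simp only [mul_eq_zero, pow_eq_zero_iff two_ne_zero, hn0, hδ0', ha0, hb0, or_false, false_or]
  have hclose : ∃ a b c : ℂ, ‖a‖ = 1 ∧ ‖b‖ = 1 ∧ ‖c‖ = 1 ∧ a ≠ b ∧ b ≠ c ∧ c ≠ a ∧
      IsTangentLine (ellipse (𝒜 w₁) (𝒜 w₂) r) (𝒜 a) (𝒜 b) ∧
      IsTangentLine (ellipse (𝒜 w₁) (𝒜 w₂) r) (𝒜 b) (𝒜 c) ∧
      IsTangentLine (ellipse (𝒜 w₁) (𝒜 w₂) r) (𝒜 c) (𝒜 a) := by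
    obtain ⟨A, B, C, h⟩ := hPoncelet
    obtain ⟨a, rfl⟩ := 𝒜.surjective A
    obtain ⟨b, rfl⟩ := 𝒜.surjective B
    obtain ⟨c, rfl⟩ := 𝒜.surjective C
    have hinj := h.affineIndependent.injective
    refine ⟨a, b, c, (hmem a).1 h.mem_A, (hmem b).1 h.mem_B, (hmem c).1 h.mem_C, ?_, ?_, ?_,
      h.tangent_AB, h.tangent_BC, h.tangent_CA⟩
    · rintro rfl; exact absurd (@hinj 0 1 rfl) (by decide)
    · rintro rfl; exact absurd (@hinj 1 2 rfl) (by decide)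
    · rintro rfl; exact absurd (@hinj 0 2 rfl) (by decide)
  have hclosure {a b c : ℂ} (ha : ‖a‖ = 1) (hb : ‖b‖ = 1) (hc : ‖c‖ = 1) (hab : a ≠ b)
      (hbc : b ≠ c) (hca : c ≠ a)
      (h1 : IsTangentLine (ellipse (𝒜 w₁) (𝒜 w₂) r) (𝒜 a) (𝒜 b))
      (h2 : IsTangentLine (ellipse (𝒜 w₁) (𝒜 w₂) r) (𝒜 b) (𝒜 c))
      (h3 : IsTangentLine (ellipse (𝒜 w₁) (𝒜 w₂) r) (𝒜 c) (𝒜 a)) :=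
    vieta_of_dualConic (by rintro rfl; simp at ha) hab hbc hca ((htan ha hb hab).1 h1)
      ((htan hb hc hbc).1 h2) ((htan hc ha hca).1 h3)
  -- Closure constrains the conic alone, so the one triangle assumed to exist gives the relation
  -- needed for all of them.
  have hk2 : (k : ℂ) = m * conj m - 1 - n * conj n := by
    obtain ⟨a, b, c, ha, hb, hc, hab, hbc, hca, h1, h2, h3⟩ := hclose
    exact (hclosure ha hb hc hab hbc hca h1 h2 h3).2.2
  have hell : ‖m ^ 2 - 4 * n‖ < ‖m‖ ^ 2 - 2 * k := by
    have e1 : m ^ 2 - 4 * n = (w₁ - w₂) ^ 2 - 4 * κ * q * conj p := by rw [hm, hn]; ring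
    have e2 : ‖m ^ 2 - 4 * n‖ ≤ ‖w₁ - w₂‖ ^ 2 + 4 * κ * ‖q‖ * ‖p‖ := by
      rw [e1]
      refine (norm_sub_le _ _).trans (le_of_eq ?_)
      simp [abs_of_pos hκ0]
    have e3 : ‖m‖ ^ 2 - 2 * k = ‖w₁ - w₂‖ ^ 2 + 2 * κ * (‖p‖ ^ 2 + ‖q‖ ^ 2) := by
      rw [hm, hk]
      simp only [← Complex.normSq_eq_norm_sq, Complex.normSq_add, Complex.normSq_sub]
      ring
    have e4 : 0 < (‖p‖ - ‖q‖) ^ 2 := by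
      have := sub_ne_zero.2 hpq
      positivity
    nlinarith [mul_pos hκ0 e4]
  -- Nestedness enters here: a tangent to the unit circle stays outside the open disc, so its image
  -- misses the inner ellipse and the discriminant has a definite sign.
  have hpos : ∀ a : ℂ, ‖a‖ = 1 → 0 < (((a + a) ^ 2 - (m + conj m * (a * a)) * (a + a) + n
        + k * (a * a) + conj n * (a * a) ^ 2) * conj a ^ 2).re := by
    intro a ha
    have h1 : a * conj a = 1 := mul_conj_of_norm_eq_one ha
    have hd : conj (Complex.I * a) * (a * a) = -(Complex.I * a) := by
      rw [map_mul, Complex.conj_I]; linear_combination -Complex.I * a * h1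
    have hD (t : ℝ) : 𝒜 a + t * (p * (Complex.I * a) + q * conj (Complex.I * a))
        = 𝒜 (a * (1 + t * Complex.I)) := by
      rw [hform, hform]
      simp only [map_mul, map_add, map_one, Complex.conj_I, Complex.conj_ofReal]
      ring
    have hD0 : p * (Complex.I * a) + q * conj (Complex.I * a) ≠ 0 := by
      intro h0
      have h2 := hD 1
      rw [h0, mul_zero, add_zero] at h2
      have h3 := 𝒜.injective h2
      rw [Complex.ofReal_one] at h3
      have h4 : a * Complex.I = 0 := by linear_combination (-1) * h3
      simp at h4
      rw [h4] at ha; simp at ha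
    have h2 := pos_of_line_disjoint_ellipse hK (A := 𝒜 a) hD0 (fun t ht => by
      rw [hD] at ht
      refine notMem_ellipseInterior_of_one_le_norm h𝒜 ?_ (hnested ht)
      rw [norm_mul, ha, one_mul]
      refine le_trans ?_ (Complex.abs_re_le_norm _)
      simp)
    have h3 := congrArg Complex.re (key ha ha hd)
    rw [Complex.ofReal_re, norm_mul, ha, Complex.norm_I, ← Complex.ofReal_pow,
      ← Complex.ofReal_pow, ← Complex.ofReal_mul, Complex.re_ofReal_mul, ← pow_two (conj a)] at h3
    rw [h3] at h2
    exact pos_of_mul_pos_right h2 (by positivity)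
  obtain ⟨f, g, hfg, hfg'⟩ := exists_add_eq_mul_eq m n
  obtain ⟨hf, hg⟩ := norm_lt_one_of_dualConic hfg hfg' hk2 hell hpos
  refine ⟨f, g, hf, hg, fun x y z => ⟨fun h => ?_, fun h => ?_⟩, ?_, ?_⟩
  · have hinj := h.affineIndependent.injective
    have hxy : x ≠ y := by rintro rfl; exact absurd (@hinj 0 1 rfl) (by decide)
    have hyz : y ≠ z := by rintro rfl; exact absurd (@hinj 1 2 rfl) (by decide)
    have hzx : z ≠ x := by rintro rfl; exact absurd (@hinj 0 2 rfl) (by decide)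
    have hx := (hmem x).1 h.mem_A
    have hy := (hmem y).1 h.mem_B
    have hz := (hmem z).1 h.mem_C
    obtain ⟨h1, h2, -⟩ := hclosure hx hy hz hxy hyz hzx h.tangent_AB h.tangent_BC h.tangent_CA
    rw [hfg, hfg']
    exact ⟨hx, hy, hz, hxy, hyz, hzx, h1, h2⟩
  · rw [hfg, hfg'] at h
    refine ⟨?_, (hmem x).2 h.norm_a, (hmem y).2 h.norm_b, (hmem z).2 h.norm_c,
      (htan h.norm_a h.norm_b h.a_ne_b).2 ?_, (htan h.norm_b h.norm_c h.b_ne_c).2 ?_,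
      (htan h.norm_c h.norm_a h.c_ne_a).2 ?_⟩
    · have h1 := (AffineEquiv.affineIndependent_iff 𝒜).2 (affineIndependent_of_norm_eq_one
        h.norm_a h.norm_b h.norm_c h.a_ne_b h.b_ne_c h.c_ne_a)
      convert h1 using 1
      ext i; fin_cases i <;> rfl
    · rw [hk2]; exact dualConic_eq_zero h.sum h.sum_mul
    · rw [hk2]
      exact dualConic_eq_zero (c := x) (by linear_combination h.sum) (by linear_combination h.sum_mul)
    · rw [hk2]
      exact dualConic_eq_zero (c := y) (by linear_combination h.sum) (by linear_combination h.sum_mul)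
  · rw [hfg, hform, hform, hm, map_add]; ring
  · rw [hfg, hfg', ← hk2, hkC, hn, hform, hform]
    simp only [map_add, map_mul, Complex.conj_conj, Complex.conj_ofReal]
    ring

/-- A sideline through a focus makes the product of focal distances zero, which is incompatible with
tangency. -/
theorem IsPonceletTriangle.ne_focus {E : Set ℂ} {G₁ G₂ A B C : ℂ} {r : ℝ} (hK : dist G₁ G₂ < r)
    (h : IsPonceletTriangle E (ellipse G₁ G₂ r) A B C) : G₁ ≠ A ∧ G₁ ≠ B ∧ G₁ ≠ C := by
  have hr : ‖G₁ - G₂‖ < r := by rwa [← dist_eq_norm]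
  have hr2 : r ^ 2 - ‖G₁ - G₂‖ ^ 2 ≠ 0 := by nlinarith [norm_nonneg (G₁ - G₂)]
  have key {X Y : ℂ} (hXY : X ≠ Y) (ht : IsTangentLine (ellipse G₁ G₂ r) X Y) : G₁ ≠ X := by
    rintro rfl
    rw [isTangentLine_iff hK hXY] at ht
    simp [hr2, sub_eq_zero, hXY.symm] at ht
  have hinj := h.affineIndependent.injective
  exact ⟨key (by rintro rfl; exact absurd (@hinj 0 1 rfl) (by decide)) h.tangent_AB,
    key (by rintro rfl; exact absurd (@hinj 1 2 rfl) (by decide)) h.tangent_BC,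
    key (by rintro rfl; exact absurd (@hinj 0 2 rfl) (by decide)) h.tangent_CA⟩

/-! ### The rational formula for the isogonal conjugate -/

/-- The coefficient of `λ ^ 0` in the numerator of the isogonal conjugate, for a family with
affine map `p z + q z̄` and Blaschke zeros of sum `m` and product `n`; primes denote conjugates. -/
def isogonalNum₀ (p q m n w p' q' _ _ w' : ℂ) : ℂ :=
  p * q * p' * m ^ 2 - p * q * p' * m * n * w' - p * q * p' * m * w + p * q * p' * n * w * w' -
  p * q * p' * n - p * q * q' * m * n * w + p * q * q' * n ^ 2 + p * q * q' * n * w ^ 2 - q ^ 2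
  * p' * w * w' + q ^ 2 * p' + q ^ 2 * q' * m * w - q ^ 2 * q' * n - q ^ 2 * q' * w ^ 2

/-- The coefficient of `λ ^ 1` in the numerator of the isogonal conjugate, for a family with
affine map `p z + q z̄` and Blaschke zeros of sum `m` and product `n`; primes denote conjugates. -/
def isogonalNum₁ (p q m n w p' q' m' n' w' : ℂ) : ℂ :=
  -p ^ 2 * p' * m + p ^ 2 * p' * n * w' + p ^ 2 * p' * w - p * q * p' * m * m' * w' + 2 * p * q
  * p' * m * n' + p * q * p' * m * w' ^ 2 - p * q * p' * n * n' * w' + p * q * p' * m' * w * w'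
  - p * q * p' * m' - p * q * p' * n' * w - p * q * q' * m * m' * w + p * q * q' * m * w * w' -
  p * q * q' * m + 2 * p * q * q' * n * m' - p * q * q' * n * n' * w - p * q * q' * n * w' + p *
  q * q' * m' * w ^ 2 - q ^ 2 * q' * m' + q ^ 2 * q' * n' * w + q ^ 2 * q' * w'

/-- The coefficient of `λ ^ 2` in the numerator of the isogonal conjugate, for a family with
affine map `p z + q z̄` and Blaschke zeros of sum `m` and product `n`; primes denote conjugates. -/
def isogonalNum₂ (p q _ _ w p' q' m' n' w' : ℂ) : ℂ :=
  p ^ 2 * p' * m' * w' - p ^ 2 * p' * n' - p ^ 2 * p' * w' ^ 2 - p ^ 2 * q' * w * w' + p ^ 2 *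
  q' - p * q * p' * m' * n' * w' + p * q * p' * n' ^ 2 + p * q * p' * n' * w' ^ 2 + p * q * q' *
  m' ^ 2 - p * q * q' * m' * n' * w - p * q * q' * m' * w' + p * q * q' * n' * w * w' - p * q *
  q' * n'

/-- The coefficient of `λ ^ 0` in the denominator of the isogonal conjugate, for a family with
affine map `p z + q z̄` and Blaschke zeros of sum `m` and product `n`; primes denote conjugates. -/
def isogonalDen₀ (_ q m n w p' _ _ _ w' : ℂ) : ℂ :=
  q * p' * m - q * p' * n * w' - q * p' * w

/-- The coefficient of `λ ^ 1` in the denominator of the isogonal conjugate, for a family with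
affine map `p z + q z̄` and Blaschke zeros of sum `m` and product `n`; primes denote conjugates. -/
def isogonalDen₁ (p q m n w p' q' m' n' w' : ℂ) : ℂ :=
  p * p' * w * w' - p * p' - p * q' * m * w + p * q' * n + p * q' * w ^ 2 - q * p' * m' * w' + q
  * p' * n' + q * p' * w' ^ 2 + q * q' * w * w' - q * q'

/-- The coefficient of `λ ^ 2` in the denominator of the isogonal conjugate, for a family with
affine map `p z + q z̄` and Blaschke zeros of sum `m` and product `n`; primes denote conjugates. -/
def isogonalDen₂ (p _ _ _ w _ q' m' n' w' : ℂ) : ℂ :=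
  p * q' * m' - p * q' * n' * w - p * q' * w'

/-- Modulo the cubic of the vertex `a`, `S - A T` splits into three factors: the barycentric weight
of `w` at `a` times `(b - a)(d - a)`, the conjugate of `P - A`, and `(B - A)(C - A)` up to the
factor `λ / ((b - a)(d - a))`. This is why one pair `S, T` serves all three vertices. -/
theorem isogonalNum_sub_mul_isogonalDen {p q m n w p' q' m' n' w' a a' l : ℂ} (ha : a * a' = 1)
    (h : a ^ 3 - (m + l * n') * a ^ 2 + (n + l * m') * a - l = 0) :
    isogonalNum₂ p q m n w p' q' m' n' w' * l ^ 2 + isogonalNum₁ p q m n w p' q' m' n' w' * l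
        + isogonalNum₀ p q m n w p' q' m' n' w'
      - (p * a + q * a') * (isogonalDen₂ p q m n w p' q' m' n' w' * l ^ 2
        + isogonalDen₁ p q m n w p' q' m' n' w' * l + isogonalDen₀ p q m n w p' q' m' n' w')
    = -((a * w + l * w' - (m + l * n') * a + a ^ 2)
        * ((p' * w' + q' * w) - (p' * a' + q' * a))
        * (l * p ^ 2 - p * q * ((m + l * n') - a) + q ^ 2 * a')) := by
  have ha0 : a ≠ 0 := left_ne_zero_of_mul_eq_one ha
  apply mul_left_cancel₀ (pow_ne_zero 2 ha0)
  linear_combination (norm := skip)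
    (-1) * (-p ^ 2 * p' * w' * a * l + p ^ 2 * q' * a ^ 2 * l + p * q * p' * m * w' * a + p * q * p' *
      n' * w' * a * l - p * q * p' * w * w' * a - p * q * p' * w' * a ^ 2 + p * q * p' * a + p *
      q * q' * m * w * a - p * q * q' * m * a ^ 2 - p * q * q' * n * a - p * q * q' * m' * a * l
      + p * q * q' * n' * w * a * l - p * q * q' * n' * a ^ 2 * l - p * q * q' * w ^ 2 * a + p *
      q * q' * w' * a * l + p * q * q' * a ^ 3 - q ^ 2 * p' * w' + q ^ 2 * q' * a) * h
    + (-a * q * (isogonalDen₂ p q m n w p' q' m' n' w' * l ^ 2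
        + isogonalDen₁ p q m n w p' q' m' n' w' * l + isogonalDen₀ p q m n w p' q' m' n' w')
      + (a * w + l * w' - (m + l * n') * a + a ^ 2)
        * (a * (p' * w' + q' * w - q' * a) * q ^ 2
          - p' * a * (l * p ^ 2 - p * q * ((m + l * n') - a))
          - p' * q ^ 2 * (a * a' + 1))) * ha
  simp only [isogonalNum₀, isogonalNum₁, isogonalNum₂, isogonalDen₀, isogonalDen₁, isogonalDen₂]
  ring

/-- The numerator of the isogonal conjugate of `p w + q w̄ + c`. -/
def isogonalNum (p q c m n w : ℂ) : ℂ[X] :=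
  C (isogonalNum₂ p q m n w (conj p) (conj q) (conj m) (conj n) (conj w)
      + c * isogonalDen₂ p q m n w (conj p) (conj q) (conj m) (conj n) (conj w)) * X ^ 2
    + C (isogonalNum₁ p q m n w (conj p) (conj q) (conj m) (conj n) (conj w)
      + c * isogonalDen₁ p q m n w (conj p) (conj q) (conj m) (conj n) (conj w)) * X
    + C (isogonalNum₀ p q m n w (conj p) (conj q) (conj m) (conj n) (conj w)
      + c * isogonalDen₀ p q m n w (conj p) (conj q) (conj m) (conj n) (conj w))

/-- The denominator of the isogonal conjugate of `p w + q w̄ + c`. -/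
def isogonalDen (p q m n w : ℂ) : ℂ[X] :=
  C (isogonalDen₂ p q m n w (conj p) (conj q) (conj m) (conj n) (conj w)) * X ^ 2
    + C (isogonalDen₁ p q m n w (conj p) (conj q) (conj m) (conj n) (conj w)) * X
    + C (isogonalDen₀ p q m n w (conj p) (conj q) (conj m) (conj n) (conj w))

theorem conj_isogonalDen₂ (p q m n w : ℂ) :
    conj (isogonalDen₂ p q m n w (conj p) (conj q) (conj m) (conj n) (conj w))
      = isogonalDen₀ p q m n w (conj p) (conj q) (conj m) (conj n) (conj w) := by
  simp only [isogonalDen₂, isogonalDen₀, map_sub, map_mul, Complex.conj_conj]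
  ring

theorem conj_isogonalDen₁ (p q m n w : ℂ) :
    conj (isogonalDen₁ p q m n w (conj p) (conj q) (conj m) (conj n) (conj w))
      = isogonalDen₁ p q m n w (conj p) (conj q) (conj m) (conj n) (conj w) := by
  simp only [isogonalDen₁, map_add, map_sub, map_mul, map_pow, Complex.conj_conj]
  ring

/-- Equivalently, `T(λ)/λ` is real for `|λ| = 1`. -/
theorem conj_isogonalDen_eval (p q m n w : ℂ) {l : ℂ} (hl : ‖l‖ = 1) :
    conj ((isogonalDen p q m n w).eval l) * l ^ 2 = (isogonalDen p q m n w).eval l := by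
  have h : l * conj l = 1 := by rw [Complex.mul_conj']; simp [hl]
  have h0 := conj_isogonalDen₂ p q m n w
  have h1 := conj_isogonalDen₁ p q m n w
  have h2 := congrArg conj h0
  rw [Complex.conj_conj] at h2
  simp only [isogonalDen, eval_add, eval_mul, eval_C, eval_pow, eval_X, map_add, map_mul, map_pow]
  rw [h0, h1, ← h2]
  linear_combination
    (isogonalDen₀ p q m n w (conj p) (conj q) (conj m) (conj n) (conj w) * (l * conj l + 1)
      + isogonalDen₁ p q m n w (conj p) (conj q) (conj m) (conj n) (conj w) * l) * h

/-! ### Reflected cevians in a Poncelet triangle -/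

/-- Reflection in the direction `v` is `x ↦ (v / v̄) x̄`, and for `v = e₁ + e₂` with unimodular `e₁,
e₂` one has `v / v̄ = e₁ e₂`. -/
theorem reflection_angleBisector {A B C : ℂ} (hB : B ≠ A) (hC : C ≠ A)
    (h : (‖B - A‖⁻¹ : ℝ) • (B - A) + (‖C - A‖⁻¹ : ℝ) • (C - A) ≠ 0) (P : ℂ) :
    EuclideanGeometry.reflection (angleBisector A B C) P
      = A + ((‖B - A‖⁻¹ * ‖C - A‖⁻¹ : ℝ) : ℂ) * (conj (P - A) * ((B - A) * (C - A))) := by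
  have hA : A ∈ angleBisector A B C := AffineSubspace.self_mem_mk' _ _
  rw [EuclideanGeometry.reflection_apply_of_mem _ _ hA]
  have key : ∀ (K : Submodule ℝ ℂ) [K.HasOrthogonalProjection] (v x : ℂ),
      K = Submodule.span ℝ {v} → v ≠ 0 → conj v * K.reflection x = v * conj x := by
    rintro _ _ v x rfl hv
    rw [Submodule.reflection_singleton_apply]
    simp only [RCLike.ofReal_real_eq_id, id_eq]
    rw [← Complex.normSq_eq_norm_sq]
    have hn : (Complex.normSq v : ℂ) ≠ 0 := by simpa using hv
    have hn' : (Complex.normSq v : ℂ) = v * conj v := (Complex.mul_conj v).symm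
    have hi : ((inner ℝ v x : ℝ) : ℂ) = (conj v * x + v * conj x) / 2 := by
      rw [Complex.inner, mul_comm]
      have := Complex.add_conj (conj v * x)
      simp only [map_mul, Complex.conj_conj] at this
      rw [this]; push_cast; rw [mul_comm]; ring
    simp only [Complex.real_smul, nsmul_eq_mul]
    simp only [Complex.ofReal_div, hi, hn']
    have hv' : conj v ≠ 0 := by simpa using hv
    push_cast
    field_simp
    ring
  have hd : (angleBisector A B C).direction = Submodule.span ℝ
      {(‖B - A‖⁻¹ : ℝ) • (B - A) + (‖C - A‖⁻¹ : ℝ) • (C - A)} := AffineSubspace.direction_mk' _ _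
  have h1 := key _ _ (P - A) hd h
  rw [vadd_eq_add, add_comm, vsub_eq_sub]
  congr 1
  have hB' : B - A ≠ 0 := sub_ne_zero.2 hB
  have hC' : C - A ≠ 0 := sub_ne_zero.2 hC
  refine mul_left_cancel₀ ((map_ne_zero (starRingEnd ℂ)).2 h) (h1.trans ?_)
  have e1 : conj (B - A) * (B - A) = (‖B - A‖ : ℂ) ^ 2 := Complex.conj_mul' _
  have e2 : conj (C - A) * (C - A) = (‖C - A‖ : ℂ) ^ 2 := Complex.conj_mul' _
  have n1 : (‖B - A‖ : ℂ) ≠ 0 := by simpa using hB'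
  have n2 : (‖C - A‖ : ℂ) ≠ 0 := by simpa using hC'
  simp only [Complex.real_smul, map_add, map_mul, Complex.conj_ofReal]
  push_cast
  field_simp
  linear_combination (-(C - A) * ‖C - A‖ * conj (P - A)) * e1
    + (-(B - A) * ‖B - A‖ * conj (P - A)) * e2

theorem mem_reflectedCevian {A B C : ℂ} (hB : B ≠ A) (hC : C ≠ A)
    (h : (‖B - A‖⁻¹ : ℝ) • (B - A) + (‖C - A‖⁻¹ : ℝ) • (C - A) ≠ 0) (P Q : ℂ) :
    Q ∈ reflectedCevian A B C P ↔
      ∃ t : ℝ, Q - A = t * (conj (P - A) * ((B - A) * (C - A))) := by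
  rw [reflectedCevian, reflection_angleBisector hB hC h, mem_line_iff]
  have hB' : ‖B - A‖ ≠ 0 := by simpa [sub_eq_zero] using hB
  have hC' : ‖C - A‖ ≠ 0 := by simpa [sub_eq_zero] using hC
  constructor
  · rintro ⟨t, rfl⟩
    exact ⟨t * (‖B - A‖⁻¹ * ‖C - A‖⁻¹), by push_cast; ring⟩
  · rintro ⟨t, ht⟩
    refine ⟨t * ‖B - A‖ * ‖C - A‖, ?_⟩
    have hB'' : (‖B - A‖ : ℂ) ≠ 0 := by exact_mod_cast hB'
    have hC'' : (‖C - A‖ : ℂ) ≠ 0 := by exact_mod_cast hC'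
    rw [eq_add_of_sub_eq ht]
    push_cast
    field_simp
    ring

theorem IsBlaschkeTriple.rotate {m n a b c : ℂ} (h : IsBlaschkeTriple m n a b c) :
    IsBlaschkeTriple m n b c a :=
  ⟨h.norm_b, h.norm_c, h.norm_a, h.b_ne_c, h.c_ne_a, h.a_ne_b,
    by linear_combination h.sum, by linear_combination h.sum_mul⟩

theorem IsBlaschkeTriple.cubic {m n a b c : ℂ} (h : IsBlaschkeTriple m n a b c) :
    a ^ 3 - (m + a * b * c * conj n) * a ^ 2 + (n + a * b * c * conj m) * a - a * b * c = 0 := by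
  linear_combination a ^ 2 * h.sum - a * h.sum_mul

section
variable {p q c m n a b d : ℂ} {𝒜 : ℂ ≃ᵃ[ℝ] ℂ}

theorem IsBlaschkeTriple.bisector_ne_zero (h : IsBlaschkeTriple m n a b d) (hpq : ‖p‖ ≠ ‖q‖)
    (hform : ∀ z, 𝒜 z = p * z + q * conj z + c) :
    (‖𝒜 b - 𝒜 a‖⁻¹ : ℝ) • (𝒜 b - 𝒜 a) + (‖𝒜 d - 𝒜 a‖⁻¹ : ℝ) • (𝒜 d - 𝒜 a) ≠ 0 := by
  intro h0
  have hs : (‖𝒜 b - 𝒜 a‖⁻¹ : ℝ) ≠ 0 := by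
    simpa [sub_eq_zero] using fun h' => h.a_ne_b (𝒜.injective h').symm
  generalize (‖𝒜 b - 𝒜 a‖⁻¹ : ℝ) = s at *
  generalize (‖𝒜 d - 𝒜 a‖⁻¹ : ℝ) = t at *
  have h1 : s * (b - a) + t * (d - a) = 0 := by
    apply eq_zero_of_affine_eq_zero hpq
    simp only [Complex.real_smul, hform] at h0
    simp only [map_add, map_sub, map_mul, Complex.conj_ofReal]
    linear_combination h0
  have h2 := congrArg conj h1
  simp only [map_add, map_sub, map_mul, Complex.conj_ofReal, map_zero] at h2
  have ha := mul_conj_of_norm_eq_one h.norm_a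
  have hb := mul_conj_of_norm_eq_one h.norm_b
  have hd := mul_conj_of_norm_eq_one h.norm_c
  have h3 : (s : ℂ) * ((b - a) * (d - b)) = 0 := by
    linear_combination (-b) * h1 - a * b * d * h2 + s * a * d * hb - (s + t) * b * d * ha
      + t * a * b * hd
  simp [hs, sub_eq_zero, h.a_ne_b.symm, h.b_ne_c.symm] at h3

/-- The difference of the isogonal conjugate and a vertex. -/
theorem IsBlaschkeTriple.num_sub_vertex_mul_den (h : IsBlaschkeTriple m n a b d)
    (hform : ∀ z, 𝒜 z = p * z + q * conj z + c) (w : ℂ) :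
    a * b * d * ((isogonalNum p q c m n w).eval (a * b * d)
        - 𝒜 a * (isogonalDen p q m n w).eval (a * b * d)) * ((b - a) * (d - a))
      = -((a * w + a * b * d * conj w - (a + b + d) * a + a ^ 2) * (a * b * d) ^ 2
        * (conj (𝒜 w - 𝒜 a) * ((𝒜 b - 𝒜 a) * (𝒜 d - 𝒜 a)))) := by
  have ha := mul_conj_of_norm_eq_one h.norm_a
  have hb := mul_conj_of_norm_eq_one h.norm_b
  have hd := mul_conj_of_norm_eq_one h.norm_c
  have key := isogonalNum_sub_mul_isogonalDen (p := p) (q := q) (w := w) (p' := conj p)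
    (q' := conj q) (w' := conj w) ha h.cubic
  rw [← h.sum] at key
  have e1 : (isogonalNum p q c m n w).eval (a * b * d)
        - 𝒜 a * (isogonalDen p q m n w).eval (a * b * d)
      = -((a * w + a * b * d * conj w - (a + b + d) * a + a ^ 2)
        * conj (𝒜 w - 𝒜 a)
        * (a * b * d * p ^ 2 - p * q * (b + d) + q ^ 2 * conj a)) := by
    rw [hform, hform]
    simp only [isogonalNum, isogonalDen, eval_add, eval_mul, eval_C, eval_pow, eval_X, map_add,
      map_sub, map_mul, Complex.conj_conj]
    linear_combination key
  have e2 : a * b * d * ((𝒜 b - 𝒜 a) * (𝒜 d - 𝒜 a))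
      = (b - a) * (d - a) * (a * b * d * p ^ 2 - p * q * (b + d) + q ^ 2 * conj a) := by
    rw [hform, hform, hform]
    generalize conj a = a' at *
    generalize conj b = b' at *
    generalize conj d = d' at *
    have ha0 := left_ne_zero_of_mul_eq_one ha
    have hb0 := left_ne_zero_of_mul_eq_one hb
    have hd0 := left_ne_zero_of_mul_eq_one hd
    obtain rfl : a' = a⁻¹ := by field_simp; linear_combination ha
    obtain rfl : b' = b⁻¹ := by field_simp; linear_combination hb
    obtain rfl : d' = d⁻¹ := by field_simp; linear_combination hd
    field_simp
    ring
  rw [e1]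
  linear_combination ((a * w + a * b * d * conj w - (a + b + d) * a + a ^ 2) * (a * b * d)
        * conj (𝒜 w - 𝒜 a)) * e2

/-- `u` is the barycentric coordinate of `w` at `a` in the triangle `a b d`; the quotient is real
because conjugation inverts the vertices. -/
theorem IsBlaschkeTriple.exists_barycentric (h : IsBlaschkeTriple m n a b d) (w : ℂ) :
    ∃ u : ℝ, a * w + a * b * d * conj w - (a + b + d) * a + a ^ 2 = u * ((b - a) * (d - a)) := by
  have ha := mul_conj_of_norm_eq_one h.norm_a
  have hb := mul_conj_of_norm_eq_one h.norm_b
  have hd := mul_conj_of_norm_eq_one h.norm_c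
  have hba : b - a ≠ 0 := sub_ne_zero.2 h.a_ne_b.symm
  have hda : d - a ≠ 0 := sub_ne_zero.2 h.c_ne_a
  have hr : conj ((a * w + a * b * d * conj w - (a + b + d) * a + a ^ 2) / ((b - a) * (d - a)))
      = (a * w + a * b * d * conj w - (a + b + d) * a + a ^ 2) / ((b - a) * (d - a)) := by
    have hba' : conj b - conj a ≠ 0 := by rw [← map_sub]; exact (_root_.map_ne_zero _).2 hba
    have hda' : conj d - conj a ≠ 0 := by rw [← map_sub]; exact (_root_.map_ne_zero _).2 hda
    simp only [map_div₀, map_add, map_sub, map_mul, map_pow, Complex.conj_conj]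
    rw [div_eq_div_iff (by positivity) (by positivity)]
    generalize conj a = a' at *
    generalize conj b = b' at *
    generalize conj d = d' at *
    have ha0 := left_ne_zero_of_mul_eq_one ha
    have hb0 := left_ne_zero_of_mul_eq_one hb
    have hd0 := left_ne_zero_of_mul_eq_one hd
    obtain rfl : a' = a⁻¹ := by field_simp; linear_combination ha
    obtain rfl : b' = b⁻¹ := by field_simp; linear_combination hb
    obtain rfl : d' = d⁻¹ := by field_simp; linear_combination hd
    field_simp
    ring
  obtain ⟨u, hu⟩ := Complex.conj_eq_iff_real.1 hr
  exact ⟨u, by rw [← hu]; field_simp⟩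

end

/-- The first factor vanishes exactly when `w` is a root of the cubic with parameter `l`, that is, a
vertex. It also divides the numerator, in the next lemma, and cancels in the quotient. -/
theorem isogonalDen_eval_of_norm_eq_one (p q m n : ℂ) {w : ℂ} (hw : ‖w‖ = 1) (l : ℂ) :
    (isogonalDen p q m n w).eval l = ((1 - conj m * w + conj n * w ^ 2) * l
      - w * (w ^ 2 - m * w + n)) * (conj p * q * conj w ^ 2 - p * conj q * conj w * l) := by
  have h := mul_conj_of_norm_eq_one hw
  simp only [isogonalDen, eval_add, eval_mul, eval_C, eval_pow, eval_X, isogonalDen₀, isogonalDen₁,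
    isogonalDen₂]
  generalize conj w = w' at *
  have hw0 := left_ne_zero_of_mul_eq_one h
  obtain rfl : w' = w⁻¹ := by field_simp; linear_combination h
  field_simp
  ring

theorem isogonalNum_eval_of_norm_eq_one (p q c m n : ℂ) {w : ℂ} (hw : ‖w‖ = 1) (l : ℂ) :
    (isogonalNum p q c m n w).eval l = ((1 - conj m * w + conj n * w ^ 2) * l
      - w * (w ^ 2 - m * w + n)) * ((-p ^ 2 * conj p * conj w ^ 2
        + p * q * conj p * conj n * conj w ^ 2 - p * q * conj q * conj m * conj w) * l
        + (p * q * conj p * m - p * q * conj q * n * w + q ^ 2 * conj q * w) * conj w ^ 2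
      + c * (conj p * q * conj w ^ 2 - p * conj q * conj w * l)) := by
  have h := mul_conj_of_norm_eq_one hw
  simp only [isogonalNum, eval_add, eval_mul, eval_C, eval_pow, eval_X, isogonalDen₀, isogonalDen₁,
    isogonalDen₂, isogonalNum₀, isogonalNum₁, isogonalNum₂]
  generalize conj w = w' at *
  have hw0 := left_ne_zero_of_mul_eq_one h
  obtain rfl : w' = w⁻¹ := by field_simp; linear_combination h
  field_simp
  ring

section
variable {p q c m n a b d : ℂ} {𝒜 : ℂ ≃ᵃ[ℝ] ℂ}

theorem IsBlaschkeTriple.prod_ne_zero (h : IsBlaschkeTriple m n a b d) : a * b * d ≠ 0 := by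
  rw [← norm_ne_zero_iff, norm_mul, norm_mul, h.norm_a, h.norm_b, h.norm_c]; norm_num

theorem IsBlaschkeTriple.norm_prod (h : IsBlaschkeTriple m n a b d) : ‖a * b * d‖ = 1 := by
  rw [norm_mul, norm_mul, h.norm_a, h.norm_b, h.norm_c]; norm_num

theorem IsBlaschkeTriple.isogonalDen_ne (h : IsBlaschkeTriple m n a b d) {w : ℂ}
    (hT : (isogonalDen p q m n w).eval (a * b * d) ≠ 0) : w ≠ a := by
  rintro rfl
  apply hT
  rw [isogonalDen_eval_of_norm_eq_one p q m n h.norm_a]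
  refine mul_eq_zero_of_left ?_ _
  linear_combination (-1) * h.cubic

theorem IsBlaschkeTriple.mem_reflectedCevian (h : IsBlaschkeTriple m n a b d) (hpq : ‖p‖ ≠ ‖q‖)
    (hform : ∀ z, 𝒜 z = p * z + q * conj z + c) {P Q : ℂ} :
    Q ∈ reflectedCevian (𝒜 a) (𝒜 b) (𝒜 d) P ↔ ∃ t : ℝ,
      Q - 𝒜 a = t * (conj (P - 𝒜 a) * ((𝒜 b - 𝒜 a) * (𝒜 d - 𝒜 a))) :=
  _root_.mem_reflectedCevian (fun h' => h.a_ne_b (𝒜.injective h').symm)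
    (fun h' => h.c_ne_a (𝒜.injective h')) (h.bisector_ne_zero hpq hform) P Q

/-- The scalar along the reflected cevian is the barycentric coordinate times `-λ/T(λ)`, which is
real by self-reciprocity. -/
theorem IsBlaschkeTriple.mem_reflectedCevian_of_eq (h : IsBlaschkeTriple m n a b d)
    (hpq : ‖p‖ ≠ ‖q‖) (hform : ∀ z, 𝒜 z = p * z + q * conj z + c) {w l : ℂ} (hl : a * b * d = l)
    (hT : (isogonalDen p q m n w).eval l ≠ 0) :
    (isogonalNum p q c m n w).eval l / (isogonalDen p q m n w).eval l
      ∈ reflectedCevian (𝒜 a) (𝒜 b) (𝒜 d) (𝒜 w) := by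
  have hba : b - a ≠ 0 := sub_ne_zero.2 h.a_ne_b.symm
  have hda : d - a ≠ 0 := sub_ne_zero.2 h.c_ne_a
  have hl0 := h.prod_ne_zero
  have hl1 := h.norm_prod
  have key := h.num_sub_vertex_mul_den hform w
  obtain ⟨u, hu⟩ := h.exists_barycentric w
  rw [hl] at hl0 hl1 key hu
  rw [hu] at key
  have hconj := conj_isogonalDen_eval p q m n w hl1
  have hll := mul_conj_of_norm_eq_one hl1
  rw [h.mem_reflectedCevian hpq hform]
  generalize (isogonalDen p q m n w).eval l = T at *
  generalize (isogonalNum p q c m n w).eval l = S at *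
  have hreal : conj (l / T) = l / T := by
    have hT' : conj T ≠ 0 := (_root_.map_ne_zero _).2 hT
    rw [map_div₀, div_eq_div_iff hT' hT]
    linear_combination (-conj l) * hconj + l * conj T * hll
  obtain ⟨v, hv⟩ := Complex.conj_eq_iff_real.1 hreal
  refine ⟨-(u * v), ?_⟩
  push_cast
  rw [← hv]
  have h1 : S - 𝒜 a * T = -(u * l * (conj (𝒜 w - 𝒜 a) * ((𝒜 b - 𝒜 a) * (𝒜 d - 𝒜 a)))) := by
    apply mul_left_cancel₀ (mul_ne_zero (mul_ne_zero hl0 hba) hda)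
    linear_combination key
  field_simp
  linear_combination h1

/-- By `hz` the scalars `t, u, v` are unnormalised barycentric coordinates of `w`. Since the right
side is linear in `Q`, comparing two vertices will determine `T`. -/
theorem IsBlaschkeTriple.mul_num_sub_mul_den (h : IsBlaschkeTriple m n a b d)
    (hform : ∀ z, 𝒜 z = p * z + q * conj z + c) {w l Q : ℂ} (hl : a * b * d = l) {t u v : ℝ}
    (ht : Q - 𝒜 a = t * (conj (𝒜 w - 𝒜 a) * ((𝒜 b - 𝒜 a) * (𝒜 d - 𝒜 a))))
    (hz : t * (w - a) + u * (w - b) + v * (w - d) = 0) :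
    (t + u + v) * ((isogonalNum p q c m n w).eval l - 𝒜 a * (isogonalDen p q m n w).eval l)
      = -l * (Q - 𝒜 a) := by
  have hba : b - a ≠ 0 := sub_ne_zero.2 h.a_ne_b.symm
  have hda : d - a ≠ 0 := sub_ne_zero.2 h.c_ne_a
  have hl0 := h.prod_ne_zero
  have key := h.num_sub_vertex_mul_den hform w
  have ha := mul_conj_of_norm_eq_one h.norm_a
  have hb := mul_conj_of_norm_eq_one h.norm_b
  have hd := mul_conj_of_norm_eq_one h.norm_c
  have hz' := congrArg conj hz
  simp only [map_add, map_sub, map_mul, Complex.conj_ofReal, map_zero] at hz'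
  have h1 : (t + u + v) * (a * w + a * b * d * conj w - (a + b + d) * a + a ^ 2)
      = t * ((b - a) * (d - a)) := by
    linear_combination a * hz + a * b * d * hz' + t * b * d * ha + u * a * d * hb + v * a * b * hd
  rw [hl] at hl0 key h1
  rw [ht]
  apply mul_left_cancel₀ (mul_ne_zero (mul_ne_zero hl0 hba) hda)
  linear_combination (t + u + v) * key
    - l ^ 2 * (conj (𝒜 w - 𝒜 a) * ((𝒜 b - 𝒜 a) * (𝒜 d - 𝒜 a))) * h1

theorem IsBlaschkeTriple.isIsogonalConjugate_iff (h : IsBlaschkeTriple m n a b d)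
    (hpq : ‖p‖ ≠ ‖q‖) (hform : ∀ z, 𝒜 z = p * z + q * conj z + c) (w Q : ℂ) :
    IsIsogonalConjugate (𝒜 a) (𝒜 b) (𝒜 d) (𝒜 w) Q ↔
      (isogonalDen p q m n w).eval (a * b * d) ≠ 0 ∧
      Q = (isogonalNum p q c m n w).eval (a * b * d) /
        (isogonalDen p q m n w).eval (a * b * d) := by
  have e1 : b * d * a = a * b * d := by ring
  have e2 : d * a * b = a * b * d := by ring
  constructor
  · intro hQ
    obtain ⟨t, ht⟩ := (h.mem_reflectedCevian hpq hform).1 hQ.mem_A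
    obtain ⟨u, hu⟩ := (h.rotate.mem_reflectedCevian hpq hform).1 hQ.mem_B
    obtain ⟨v, hv⟩ := (h.rotate.rotate.mem_reflectedCevian hpq hform).1 hQ.mem_C
    have hAB : 𝒜 b - 𝒜 a ≠ 0 := sub_ne_zero.2 fun h' => h.a_ne_b (𝒜.injective h').symm
    have hBC : 𝒜 d - 𝒜 b ≠ 0 := sub_ne_zero.2 fun h' => h.b_ne_c (𝒜.injective h').symm
    have hCA : 𝒜 d - 𝒜 a ≠ 0 := sub_ne_zero.2 fun h' => h.c_ne_a (𝒜.injective h')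
    -- Eliminate `Q` with `(Q - A)(C - B) - (Q - B)(C - A) + (Q - C)(B - A) = 0`; each cevian
    -- equation contributes the same product of sides up to sign.
    have hsum : t * conj (𝒜 w - 𝒜 a) + u * conj (𝒜 w - 𝒜 b) + v * conj (𝒜 w - 𝒜 d) = 0 := by
      apply mul_left_cancel₀ (mul_ne_zero (mul_ne_zero hAB hCA) hBC)
      linear_combination (-(𝒜 d - 𝒜 b)) * ht + (𝒜 d - 𝒜 a) * hu - (𝒜 b - 𝒜 a) * hv
    have hz : t * (w - a) + u * (w - b) + v * (w - d) = 0 := by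
      apply eq_zero_of_affine_eq_zero hpq
      have hsum' := congrArg conj hsum
      simp only [map_add, map_mul, Complex.conj_ofReal, map_zero, Complex.conj_conj,
        hform] at hsum'
      simp only [map_add, map_sub, map_mul, Complex.conj_ofReal]
      linear_combination hsum'
    have k1 := h.mul_num_sub_mul_den hform rfl ht hz
    have k2 := h.rotate.mul_num_sub_mul_den hform e1 (t := u) (u := v) (v := t) hu
      (by linear_combination hz)
    -- Subtracting the relations at two vertices removes both `S` and `Q`. As `λ ≠ 0`, concurrence
    -- forces `T(λ) ≠ 0`.
    have k3 : (t + u + v) * (isogonalDen p q m n w).eval (a * b * d) = -(a * b * d) := by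
      apply mul_left_cancel₀ hAB
      linear_combination k1 - k2
    have hT : (isogonalDen p q m n w).eval (a * b * d) ≠ 0 := by
      intro h0
      rw [h0, mul_zero] at k3
      exact h.prod_ne_zero (by linear_combination k3)
    refine ⟨hT, ?_⟩
    rw [eq_div_iff hT]
    apply mul_left_cancel₀ h.prod_ne_zero
    linear_combination (isogonalDen p q m n w).eval (a * b * d) * k1
      - ((isogonalNum p q c m n w).eval (a * b * d)
        - 𝒜 a * (isogonalDen p q m n w).eval (a * b * d)) * k3
  · rintro ⟨hT, rfl⟩
    exact ⟨𝒜.injective.ne (h.isogonalDen_ne hT),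
      𝒜.injective.ne (h.rotate.isogonalDen_ne (by rwa [e1])),
      𝒜.injective.ne (h.rotate.rotate.isogonalDen_ne (by rwa [e2])),
      h.mem_reflectedCevian_of_eq hpq hform rfl hT,
      h.rotate.mem_reflectedCevian_of_eq hpq hform e1 hT,
      h.rotate.rotate.mem_reflectedCevian_of_eq hpq hform e2 hT⟩

/-! ### Isogonality of the foci -/

/-- At each vertex of a Poncelet triangle the lines to the foci of the inscribed ellipse are
isogonal. -/
theorem IsBlaschkeTriple.foci_mem_reflectedCevian (h : IsBlaschkeTriple m n a b d)
    (hpq : ‖p‖ ≠ ‖q‖) (hform : ∀ z, 𝒜 z = p * z + q * conj z + c) {G₁ G₂ : ℂ}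
    (hsum : G₁ + G₂ = p * m + q * conj m + 2 * c)
    (hprod : (G₁ - c) * (G₂ - c) = p ^ 2 * n + q ^ 2 * conj n
      + p * q * (m * conj m - 1 - n * conj n)) (hne : G₁ ≠ 𝒜 a) :
    G₂ ∈ reflectedCevian (𝒜 a) (𝒜 b) (𝒜 d) G₁ := by
  rw [h.mem_reflectedCevian hpq hform]
  have ha := mul_conj_of_norm_eq_one h.norm_a
  have hb := mul_conj_of_norm_eq_one h.norm_b
  have hd := mul_conj_of_norm_eq_one h.norm_c
  have hba : b - a ≠ 0 := sub_ne_zero.2 h.a_ne_b.symm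
  have hda : d - a ≠ 0 := sub_ne_zero.2 h.c_ne_a
  have hB : a ^ 2 - m * a + n = b * d * (1 - conj m * a + conj n * a ^ 2) := by
    linear_combination a * h.sum - h.sum_mul
  obtain ⟨ρ, hρ⟩ : ∃ ρ : ℝ, a ^ 2 - m * a + n = ρ * ((b - a) * (d - a)) := by
    have hr : conj ((a ^ 2 - m * a + n) / ((b - a) * (d - a)))
        = (a ^ 2 - m * a + n) / ((b - a) * (d - a)) := by
      have hba' : conj b - conj a ≠ 0 := by
        rw [← map_sub]; exact (_root_.map_ne_zero _).2 hba
      have hda' : conj d - conj a ≠ 0 := by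
        rw [← map_sub]; exact (_root_.map_ne_zero _).2 hda
      simp only [map_div₀, map_add, map_sub, map_mul, map_pow]
      rw [div_eq_div_iff (by positivity) (by positivity), hB]
      generalize conj a = a' at *
      generalize conj b = b' at *
      generalize conj d = d' at *
      have ha0 := left_ne_zero_of_mul_eq_one ha
      have hb0 := left_ne_zero_of_mul_eq_one hb
      have hd0 := left_ne_zero_of_mul_eq_one hd
      obtain rfl : a' = a⁻¹ := by field_simp; linear_combination ha
      obtain rfl : b' = b⁻¹ := by field_simp; linear_combination hb
      obtain rfl : d' = d⁻¹ := by field_simp; linear_combination hd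
      field_simp
      ring
    obtain ⟨ρ, hρ⟩ := Complex.conj_eq_iff_real.1 hr
    exact ⟨ρ, by rw [← hρ]; field_simp⟩
  -- A real ratio between these products says that the two focal directions are symmetric in the
  -- bisector. `f1` and `f2` extract the common factor `a² - m a + n` from the three terms of the
  -- left side.
  have key : (G₁ - 𝒜 a) * (G₂ - 𝒜 a) = ρ * ((𝒜 b - 𝒜 a) * (𝒜 d - 𝒜 a)) := by
    have e1 : (G₁ - 𝒜 a) * (G₂ - 𝒜 a) = p ^ 2 * (a ^ 2 - m * a + n)
        + q ^ 2 * (conj a ^ 2 - conj m * conj a + conj n)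
        + p * q * (2 - conj m * a - m * conj a + m * conj m - 1 - n * conj n) := by
      rw [hform]
      linear_combination hprod - (p * a + q * conj a) * hsum + 2 * p * q * ha
    have e2 : (𝒜 b - 𝒜 a) * (𝒜 d - 𝒜 a) = (b - a) * (d - a)
        * (p ^ 2 - p * q * conj a * (conj b + conj d)
          + q ^ 2 * (conj a ^ 2 * conj b * conj d)) := by
      rw [hform, hform, hform]
      generalize conj a = a' at *
      generalize conj b = b' at *
      generalize conj d = d' at *
      have ha0 := left_ne_zero_of_mul_eq_one ha
      have hb0 := left_ne_zero_of_mul_eq_one hb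
      have hd0 := left_ne_zero_of_mul_eq_one hd
      obtain rfl : a' = a⁻¹ := by field_simp; linear_combination ha
      obtain rfl : b' = b⁻¹ := by field_simp; linear_combination hb
      obtain rfl : d' = d⁻¹ := by field_simp; linear_combination hd
      field_simp
      ring
    have f1 : conj a ^ 2 - conj m * conj a + conj n
        = conj a ^ 2 * conj b * conj d * (a ^ 2 - m * a + n) := by
      rw [hB]
      linear_combination (-(conj m * conj a) + conj n * (a * conj a + 1)) * (-1) * ha
        - (conj a ^ 2 * (1 - conj m * a + conj n * a ^ 2)) * (b * conj b) * hd
        - (conj a ^ 2 * (1 - conj m * a + conj n * a ^ 2)) * hb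
    have f2 : 2 - conj m * a - m * conj a + m * conj m - 1 - n * conj n
        = -(conj a * (conj b + conj d) * (a ^ 2 - m * a + n)) := by
      have hlin : (1 - conj m * a + conj n * a ^ 2) * (b + d)
          + (2 * a - m - conj m * a ^ 2 + (m * conj m - 1 - n * conj n) * a) = 0 := by
        linear_combination (1 - conj m * a + conj n * a ^ 2) * h.sum - conj n * h.cubic
      rw [hB]
      linear_combination conj a * hlin
        + conj a * (1 - conj m * a + conj n * a ^ 2) * (d * hb + b * hd)
        - (2 - conj m * a + m * conj m - 1 - n * conj n) * ha
    rw [e1, e2, f1, f2]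
    linear_combination (p ^ 2 - p * q * conj a * (conj b + conj d)
          + q ^ 2 * (conj a ^ 2 * conj b * conj d)) * hρ
  have hne' : G₁ - 𝒜 a ≠ 0 := sub_ne_zero.2 hne
  have hn0 : (‖G₁ - 𝒜 a‖ : ℂ) ≠ 0 := by simpa using hne'
  have hn1 : (G₁ - 𝒜 a) * conj (G₁ - 𝒜 a) = (‖G₁ - 𝒜 a‖ : ℂ) ^ 2 := Complex.mul_conj' _
  refine ⟨ρ / ‖G₁ - 𝒜 a‖ ^ 2, ?_⟩
  push_cast
  field_simp
  apply mul_left_cancel₀ hne'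
  linear_combination ‖G₁ - 𝒜 a‖ ^ 2 * key
    - ρ * ((𝒜 b - 𝒜 a) * (𝒜 d - 𝒜 a)) * hn1

end

/-! ### The eliminant and its degree -/

theorem resultant_two_two {R : Type*} [CommRing R] (f g : R[X]) :
    Polynomial.resultant f g 2 2
      = (f.coeff 2 * g.coeff 0 - f.coeff 0 * g.coeff 2) ^ 2
        - (f.coeff 2 * g.coeff 1 - f.coeff 1 * g.coeff 2)
          * (f.coeff 1 * g.coeff 0 - f.coeff 0 * g.coeff 1) := by
  have h : Polynomial.sylvester f g 2 2 =
      !![g.coeff 0, 0, f.coeff 0, 0; g.coeff 1, g.coeff 0, f.coeff 1, f.coeff 0;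
        g.coeff 2, g.coeff 1, f.coeff 2, f.coeff 1; 0, g.coeff 2, 0, f.coeff 2] := by
    ext i j
    fin_cases i <;> fin_cases j <;> rfl
  rw [Polynomial.resultant, h, Matrix.det_succ_row_zero]
  simp [Fin.sum_univ_succ, Matrix.det_fin_three, Fin.succAbove]
  ring

theorem conjReciprocal_coeff {S : ℂ[X]} {i j : ℕ} (h : i + j = 2) :
    (conjReciprocal S).coeff i = conj (S.coeff j) := by
  rw [conjReciprocal, coeff_reflect, revAt_le (by omega), coeff_map]
  congr 2
  omega

theorem eliminant_eq (S T : ℂ[X]) :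
    eliminant S T =
      let z : MvPolynomial (Fin 2) ℂ := .X 0 + .C Complex.I * .X 1
      let z' : MvPolynomial (Fin 2) ℂ := .X 0 - .C Complex.I * .X 1
      let f (i : ℕ) : MvPolynomial (Fin 2) ℂ := .C (S.coeff i) - z * .C (T.coeff i)
      let g (i : ℕ) : MvPolynomial (Fin 2) ℂ := .C (conj (S.coeff i)) - z' * .C (conj (T.coeff i))
      (f 2 * g 2 - f 0 * g 0) ^ 2 - (f 2 * g 1 - f 1 * g 0) * (f 1 * g 2 - f 0 * g 1) := by
  simp only [eliminant, resultant_two_two, coeff_sub, coeff_C_mul, coeff_map,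
    conjReciprocal_coeff (i := 0) (j := 2) rfl, conjReciprocal_coeff (i := 1) (j := 1) rfl,
    conjReciprocal_coeff (i := 2) (j := 0) rfl]

theorem totalDegree_affine_le (a b c : ℂ) :
    (.C a - (.X 0 + .C Complex.I * .X 1) * .C b - (.X 0 - .C Complex.I * .X 1) * .C c :
      MvPolynomial (Fin 2) ℂ).totalDegree ≤ 1 := by
  have h0 : (.X 0 : MvPolynomial (Fin 2) ℂ).totalDegree ≤ 1 := by simp
  have h1 : (.C Complex.I * .X 1 : MvPolynomial (Fin 2) ℂ).totalDegree ≤ 1 :=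
    (MvPolynomial.totalDegree_mul _ _).trans (by simp)
  have hC (e : ℂ) : (.C e : MvPolynomial (Fin 2) ℂ).totalDegree ≤ 0 := by simp
  refine (MvPolynomial.totalDegree_sub _ _).trans (max_le ((MvPolynomial.totalDegree_sub _ _).trans
    (max_le ((hC _).trans zero_le_one) ?_)) ?_)
  · exact (MvPolynomial.totalDegree_mul _ _).trans
      (add_le_add ((MvPolynomial.totalDegree_add _ _).trans (max_le h0 h1)) (hC _))
  · exact (MvPolynomial.totalDegree_mul _ _).trans
      (add_le_add ((MvPolynomial.totalDegree_sub _ _).trans (max_le h0 h1)) (hC _))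

/-- The same `b, b'` occur crosswise in the two linear pencils, so the quadratic term `(x + iy)(x -
iy) b b'` cancels from the minor. -/
theorem totalDegree_minor_le (a b c a' b' c' : ℂ) :
    ((.C a - (.X 0 + .C Complex.I * .X 1) * .C b) * (.C c' - (.X 0 - .C Complex.I * .X 1) * .C b')
      - (.C a' - (.X 0 + .C Complex.I * .X 1) * .C b')
        * (.C c - (.X 0 - .C Complex.I * .X 1) * .C b) :
      MvPolynomial (Fin 2) ℂ).totalDegree ≤ 1 := by
  refine le_of_eq_of_le (congrArg _ ?_)
    (totalDegree_affine_le (a * c' - a' * c) (b * c' - b' * c) (a * b' - a' * b))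
  simp only [MvPolynomial.C_sub, MvPolynomial.C_mul]
  ring

/-- The hypotheses say `T* = T`, which brings every minor in the resultant to the form where the
quadratic part cancels. -/
theorem totalDegree_eliminant_le {S T : ℂ[X]} (h₀ : conj (T.coeff 2) = T.coeff 0)
    (h₁ : conj (T.coeff 1) = T.coeff 1) : (eliminant S T).totalDegree ≤ 2 := by
  have h₂ : conj (T.coeff 0) = T.coeff 2 := by rw [← h₀, Complex.conj_conj]
  rw [eliminant_eq]
  simp only [h₀, h₁, h₂]
  refine (MvPolynomial.totalDegree_sub _ _).trans (max_le ?_ ?_)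
  · exact (MvPolynomial.totalDegree_pow _ _).trans
      (Nat.mul_le_mul_left 2 (totalDegree_minor_le _ _ _ _ _ _))
  · exact (MvPolynomial.totalDegree_mul _ _).trans
      (add_le_add (totalDegree_minor_le _ _ _ _ _ _) (totalDegree_minor_le _ _ _ _ _ _))

theorem eval_eliminant (S T : ℂ[X]) (z : ℂ) :
    MvPolynomial.eval ![(z.re : ℂ), (z.im : ℂ)] (eliminant S T) =
      let f (i : ℕ) : ℂ := S.coeff i - z * T.coeff i
      (f 2 * conj (f 2) - f 0 * conj (f 0)) ^ 2
        - (f 2 * conj (f 1) - f 1 * conj (f 0)) * (f 1 * conj (f 2) - f 0 * conj (f 1)) := by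
  have h1 : (z.re : ℂ) + Complex.I * z.im = z := by rw [mul_comm]; exact Complex.re_add_im z
  have h2 : (z.re : ℂ) - Complex.I * z.im = conj z := by
    apply Complex.ext <;> simp
  rw [eliminant_eq]
  simp [h1, h2]

/-! ### The image of the unit circle as a real conic -/

/-- The points `S(λ) / T(λ)` with `|λ| = 1`. -/
def unitCircleImage (S T : ℂ[X]) : Set ℂ :=
  {Q : ℂ | ∃ l : ℂ, ‖l‖ = 1 ∧ T.eval l ≠ 0 ∧ Q = S.eval l / T.eval l}

/-- The determinant of the projective map which sends the unit circle to the locus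
`S(λ) / T(λ)`. -/
def circleDet (s₂ s₁ s₀ t₂ t₁ t₀ : ℂ) : ℂ :=
  s₂ * (conj s₁ * t₀ - conj s₂ * t₁) - s₁ * (conj s₀ * t₀ - conj s₂ * t₂)
    + s₀ * (conj s₀ * t₁ - conj s₁ * t₂)

section
variable {S T : ℂ[X]} {s₂ s₁ s₀ t₂ : ℂ} {t₁ : ℝ}

theorem exists_den_ne_zero (hT : T = C t₂ * X ^ 2 + C (t₁ : ℂ) * X + C (conj t₂))
    (hdet : circleDet s₂ s₁ s₀ t₂ t₁ (conj t₂) ≠ 0) : ∃ l : ℂ, ‖l‖ = 1 ∧ T.eval l ≠ 0 := by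
  by_contra! h
  have h1 := h 1 (by simp)
  have h2 := h (-1) (by simp)
  have h3 := h Complex.I (by simp)
  simp only [hT, eval_add, eval_mul, eval_C, eval_pow, eval_X, Complex.I_sq] at h1 h2 h3
  have e1 : (t₁ : ℂ) = 0 := by linear_combination (h1 - h2) / 2
  have e2 : t₂ = 0 := by linear_combination (h1 - h3) / 2 - (1 - Complex.I) / 2 * e1
  apply hdet
  simp [circleDet, e1, e2]

/-- `circleDet` is the determinant of the coefficient rows of `S`, `S*`, `T`; a common root of `S`
and `T` on the circle is also a root of `S*` and gives a kernel vector. -/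
theorem eq_zero_of_circleDet_ne_zero (hdet : circleDet s₂ s₁ s₀ t₂ t₁ (conj t₂) ≠ 0)
    {l : ℂ} (hl : ‖l‖ = 1) (hS : s₂ * l ^ 2 + s₁ * l + s₀ = 0)
    (hT : t₂ * l ^ 2 + t₁ * l + conj t₂ = 0) : False := by
  have h := mul_conj_of_norm_eq_one hl
  have hl0 := left_ne_zero_of_mul_eq_one h
  have hS' : conj s₀ * l ^ 2 + conj s₁ * l + conj s₂ = 0 := by
    have := congrArg conj hS
    simp only [map_add, map_mul, map_pow, map_zero] at this
    linear_combination l ^ 2 * this - (conj s₂ * (l * conj l + 1) + conj s₁ * l) * h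
  apply hdet
  apply mul_left_cancel₀ hl0
  rw [circleDet]
  linear_combination (-1) * (conj s₀ * conj t₂ - conj s₂ * t₂) * hS
    + (s₂ * conj t₂ - s₀ * t₂) * hS' - (s₂ * conj s₂ - s₀ * conj s₀) * hT

theorem mem_unitCircleImage_iff (hS : S = C s₂ * X ^ 2 + C s₁ * X + C s₀)
    (hT : T = C t₂ * X ^ 2 + C (t₁ : ℂ) * X + C (conj t₂))
    (hdet : circleDet s₂ s₁ s₀ t₂ t₁ (conj t₂) ≠ 0) (z : ℂ) :
    z ∈ unitCircleImage S T ↔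
      MvPolynomial.eval ![(z.re : ℂ), (z.im : ℂ)] (eliminant S T) = 0 := by
  have hS2 : S.coeff 2 = s₂ := by simp [hS]
  have hS1 : S.coeff 1 = s₁ := by simp [hS]
  have hS0 : S.coeff 0 = s₀ := by simp [hS]
  have hT2 : T.coeff 2 = t₂ := by simp [hT]
  have hT1 : T.coeff 1 = t₁ := by simp [hT]
  have hT0 : T.coeff 0 = conj t₂ := by simp [hT]
  rw [eval_eliminant]
  simp only [hS2, hS1, hS0, hT2, hT1, hT0]
  obtain ⟨f₂, hf2⟩ : ∃ f₂, f₂ = s₂ - z * t₂ := ⟨_, rfl⟩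
  obtain ⟨f₁, hf1⟩ : ∃ f₁, f₁ = s₁ - z * t₁ := ⟨_, rfl⟩
  obtain ⟨f₀, hf0⟩ : ∃ f₀, f₀ = s₀ - z * conj t₂ := ⟨_, rfl⟩
  simp only [unitCircleImage, Set.mem_ofPred_eq, hS, hT, eval_add, eval_mul, eval_C, eval_pow,
    eval_X]
  rw [← hf2, ← hf1, ← hf0]
  constructor
  · rintro ⟨l, hl, hTl, hz⟩
    have h := mul_conj_of_norm_eq_one hl
    have e : f₀ = -(f₂ * l ^ 2 + f₁ * l) := by
      rw [eq_div_iff hTl] at hz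
      rw [hf0, hf1, hf2]
      linear_combination -hz
    have hl0 := left_ne_zero_of_mul_eq_one h
    rw [e]
    simp only [map_neg, map_add, map_mul, map_pow]
    generalize conj l = l' at *
    obtain rfl : l' = l⁻¹ := by field_simp; linear_combination h
    field_simp
    ring
  · intro hR
    obtain ⟨v, hv⟩ : ∃ v : ℝ, (v : ℂ) = f₂ * conj f₂ - f₀ * conj f₀ :=
      ⟨‖f₂‖ ^ 2 - ‖f₀‖ ^ 2, by rw [Complex.mul_conj', Complex.mul_conj']; push_cast; rfl⟩
    obtain ⟨y, hy⟩ : ∃ y, y = f₂ * conj f₁ - f₁ * conj f₀ := ⟨_, rfl⟩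
    have hy' : conj y = f₁ * conj f₂ - f₀ * conj f₁ := by
      rw [hy]; simp only [map_sub, map_mul, Complex.conj_conj]; ring
    rw [← hy, ← hy', ← hv, Complex.mul_conj'] at hR
    have hR' : v ^ 2 = ‖y‖ ^ 2 := by exact_mod_cast sub_eq_zero.1 hR
    -- The eliminant is `v² - |y|²`. If `y = 0`, all `2 × 2` minors of `S - zT` and its reciprocal
    -- vanish, and `circleDet` is a combination of these minors.
    have hy0 : y ≠ 0 := by
      rintro rfl
      have hv0 : v = 0 := by simpa using hR'
      rw [hv0, Complex.ofReal_zero] at hv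
      rw [map_zero] at hy'
      apply hdet
      simp only [hf2, hf1, hf0, map_sub, map_mul, Complex.conj_conj, Complex.conj_ofReal] at hv hy hy'
      rw [circleDet]
      linear_combination (-conj t₂) * hy + t₁ * hv - t₂ * hy'
    -- The common root of the two quadratics, found from their minors; `v² = |y|²` makes it
    -- unimodular.
    have hl : ‖-(v : ℂ) / y‖ = 1 := by
      rw [norm_div, norm_neg, Complex.norm_real, Real.norm_eq_abs,
        (pow_left_inj₀ (abs_nonneg v) (norm_nonneg y) two_ne_zero).1 (by rw [sq_abs, hR'])]
      exact div_self (norm_ne_zero_iff.2 hy0)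
    have hroot : f₂ * (-(v : ℂ) / y) ^ 2 + f₁ * (-(v : ℂ) / y) + f₀ = 0 := by
      have hvy : (v : ℂ) ^ 2 = y * conj y := by rw [Complex.mul_conj']; exact_mod_cast hR'
      field_simp
      linear_combination f₂ * hvy + y * (f₂ * hy' - f₁ * hv + f₀ * hy)
    generalize -(v : ℂ) / y = l at *
    have hTl : t₂ * l ^ 2 + t₁ * l + conj t₂ ≠ 0 := fun hTl =>
      eq_zero_of_circleDet_ne_zero hdet hl (by
        rw [hf2, hf1, hf0] at hroot; linear_combination hroot + z * hTl) hTl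
    refine ⟨l, hl, hTl, ?_⟩
    rw [eq_div_iff hTl]
    rw [hf2, hf1, hf0] at hroot
    linear_combination -hroot

theorem isNondegenerateConic_unitCircleImage (hS : S = C s₂ * X ^ 2 + C s₁ * X + C s₀)
    (hT : T = C t₂ * X ^ 2 + C (t₁ : ℂ) * X + C (conj t₂))
    (hdet : circleDet s₂ s₁ s₀ t₂ t₁ (conj t₂) ≠ 0) :
    IsNondegenerateConic (unitCircleImage S T) := by
  -- On the circle `M` sends `(Re λ, Im λ, 1)` to `(Re(S/λ), Im(S/λ), T/λ)`, and `det M =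
  -- -circleDet`. The conic is the transport by `M` of `x² + y² - 1 = 0`.
  obtain ⟨M, hM⟩ : ∃ M : Matrix (Fin 3) (Fin 3) ℝ,
      M = !![(s₂ + s₀).re, (s₀ - s₂).im, s₁.re; (s₂ + s₀).im, (s₂ - s₀).re, s₁.im;
        2 * t₂.re, -2 * t₂.im, t₁] := ⟨_, rfl⟩
  have hMdet : M.det ≠ 0 := by
    intro h0
    apply hdet
    have : circleDet s₂ s₁ s₀ t₂ t₁ (conj t₂) = ((-M.det : ℝ) : ℂ) := by
      rw [hM, Matrix.det_fin_three, circleDet]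
      apply Complex.ext
      · simp; ring
      · simp; ring
    rw [this, h0]; simp
  have hinv : M * M⁻¹ = 1 := Matrix.mul_nonsing_inv _ (isUnit_iff_ne_zero.2 hMdet)
  have hinv' : M⁻¹ * M = 1 := Matrix.nonsing_inv_mul _ (isUnit_iff_ne_zero.2 hMdet)
  have heval (l : ℂ) (hl : ‖l‖ = 1) : ∃ τ : ℝ, T.eval l = l * τ ∧
      M.mulVec ![l.re, l.im, 1] = ![(S.eval l * conj l).re, (S.eval l * conj l).im, τ] := by
    have h := mul_conj_of_norm_eq_one hl
    have e1 : S.eval l * conj l = s₂ * l + s₁ + s₀ * conj l := by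
      simp only [hS, eval_add, eval_mul, eval_C, eval_pow, eval_X]
      linear_combination (s₂ * l + s₁) * h
    have e2 : T.eval l = l * (t₂ * l + t₁ + conj (t₂ * l)) := by
      simp only [hT, eval_add, eval_mul, eval_C, eval_pow, eval_X, map_mul]
      linear_combination -conj t₂ * h
    refine ⟨2 * t₂.re * l.re - 2 * t₂.im * l.im + t₁, ?_, ?_⟩
    · rw [e2]
      congr 1
      apply Complex.ext <;> simp <;> ring
    · rw [e1, hM]
      ext i
      fin_cases i
      · simp [Matrix.mulVec, dotProduct, Fin.sum_univ_three]; ring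
      · simp [Matrix.mulVec, dotProduct, Fin.sum_univ_three]; ring
      · simp [Matrix.mulVec, dotProduct, Fin.sum_univ_three]; ring
  have hquad (u : Fin 3 → ℝ) : u ⬝ᵥ ((M⁻¹).transpose * Matrix.diagonal ![1, 1, -1] * M⁻¹).mulVec u
      = (M⁻¹.mulVec u 0) ^ 2 + (M⁻¹.mulVec u 1) ^ 2 - (M⁻¹.mulVec u 2) ^ 2 := by
    rw [← Matrix.mulVec_mulVec, ← Matrix.mulVec_mulVec, Matrix.dotProduct_mulVec,
      Matrix.vecMul_transpose]
    generalize M⁻¹.mulVec u = h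
    simp [dotProduct, Fin.sum_univ_three, Matrix.mulVec_diagonal]
    ring
  refine ⟨?_, (M⁻¹).transpose * Matrix.diagonal ![1, 1, -1] * M⁻¹, ?_, ?_, ?_⟩
  · obtain ⟨l, hl, hl'⟩ := exists_den_ne_zero hT hdet
    exact ⟨_, l, hl, hl', rfl⟩
  · rw [Matrix.IsSymm, Matrix.transpose_mul, Matrix.transpose_mul, Matrix.diagonal_transpose,
      Matrix.transpose_transpose, Matrix.mul_assoc]
  · rw [Matrix.det_mul, Matrix.det_mul, Matrix.det_transpose, Matrix.det_diagonal,
      Matrix.det_nonsing_inv]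
    simp [Fin.prod_univ_three, hMdet]
  · ext z
    simp only [Set.mem_ofPred_eq, hquad]
    constructor
    · rintro ⟨l, hl, hTl, rfl⟩
      obtain ⟨τ, hτ, hMl⟩ := heval l hl
      have hl0 : l ≠ 0 := by rintro rfl; simp at hl
      have hτ0 : τ ≠ 0 := by rintro rfl; simp [hτ] at hTl
      have hinvl : conj l = l⁻¹ := (Complex.inv_eq_conj hl).symm
      have hz : S.eval l / T.eval l = (τ⁻¹ : ℝ) * (S.eval l * conj l) := by
        have hτ0' : (τ : ℂ) ≠ 0 := by exact_mod_cast hτ0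
        rw [hτ, hinvl]
        push_cast
        field_simp
      have hu : ![(S.eval l / T.eval l).re, (S.eval l / T.eval l).im, 1]
          = τ⁻¹ • M.mulVec ![l.re, l.im, 1] := by
        rw [hMl, hz, Complex.re_ofReal_mul, Complex.im_ofReal_mul]
        ext i
        fin_cases i <;> simp [hτ0]
      rw [hu, Matrix.mulVec_smul, Matrix.mulVec_mulVec, hinv', Matrix.one_mulVec]
      have hn : l.re ^ 2 + l.im ^ 2 = 1 := by
        have := Complex.sq_norm l
        rw [hl, Complex.normSq_apply] at this
        linarith
      simp only [Pi.smul_apply, Matrix.cons_val, smul_eq_mul]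
      linear_combination τ⁻¹ ^ 2 * hn
    · intro h0
      obtain ⟨h, hh⟩ : ∃ h, h = M⁻¹.mulVec ![z.re, z.im, 1] := ⟨_, rfl⟩
      have hMh : M.mulVec h = ![z.re, z.im, 1] := by
        rw [hh, Matrix.mulVec_mulVec, hinv, Matrix.one_mulVec]
      rw [← hh] at h0
      -- The unit circle has no real point at infinity, so every preimage under `M` is an affine
      -- point.
      have h2 : h 2 ≠ 0 := by
        intro h2
        have h00 : h 0 = 0 := by nlinarith [sq_nonneg (h 0), sq_nonneg (h 1)]
        have h11 : h 1 = 0 := by nlinarith [sq_nonneg (h 0), sq_nonneg (h 1)]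
        have : h = 0 := by ext i; fin_cases i <;> simp [h00, h11, h2]
        rw [this, Matrix.mulVec_zero] at hMh
        simpa using congrFun hMh 2
      obtain ⟨l, hl⟩ : ∃ l : ℂ, l = ⟨h 0 / h 2, h 1 / h 2⟩ := ⟨_, rfl⟩
      have hl1 : ‖l‖ = 1 := by
        rw [← pow_eq_one_iff_of_nonneg (norm_nonneg l) two_ne_zero, Complex.sq_norm,
          Complex.normSq_apply, hl]
        field_simp
        linarith
      have hhl : h = h 2 • ![l.re, l.im, 1] := by
        rw [hl]
        ext i
        fin_cases i
        · simp; field_simp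
        · simp; field_simp
        · simp
      obtain ⟨τ, hτ, hMl⟩ := heval l hl1
      rw [hhl, Matrix.mulVec_smul, hMl] at hMh
      have k0 := congrFun hMh 0
      have k1 := congrFun hMh 1
      have k2 := congrFun hMh 2
      simp only [Pi.smul_apply, Matrix.cons_val, smul_eq_mul] at k0 k1 k2
      have hl0 : l ≠ 0 := by rintro rfl; simp at hl1
      have hτ0 : (τ : ℂ) ≠ 0 := by
        have := right_ne_zero_of_mul_eq_one k2
        exact_mod_cast this
      have hTl : T.eval l ≠ 0 := by rw [hτ]; exact mul_ne_zero hl0 hτ0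
      refine ⟨l, hl1, hTl, ?_⟩
      have hz : z = (h 2 : ℂ) * (S.eval l * conj l) := by
        apply Complex.ext
        · rw [Complex.re_ofReal_mul, k0]
        · rw [Complex.im_ofReal_mul, k1]
      have k2' : (h 2 : ℂ) * τ = 1 := by exact_mod_cast k2
      rw [eq_div_iff hTl, hz, hτ]
      have hll := mul_conj_of_norm_eq_one hl1
      linear_combination S.eval l * l * conj l * k2' + S.eval l * hll

/-- Needed to exclude a zero eliminant, whose zero set would be the whole plane. -/
theorem IsNondegenerateConic.ne_univ {K : Set ℂ} (h : IsNondegenerateConic K) :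
    K ≠ Set.univ := by
  rintro rfl
  obtain ⟨-, q, hq, hdet, hK⟩ := h
  have hz (z : ℂ) : ![z.re, z.im, 1] ⬝ᵥ q.mulVec ![z.re, z.im, 1] = 0 := by
    have := Set.mem_univ z
    rwa [hK] at this
  have hsymm (i j) : q i j = q j i := hq.apply j i
  have h1 := hz 0
  have h2 := hz 1
  have h3 := hz (-1)
  have h4 := hz Complex.I
  have h5 := hz (-Complex.I)
  have h6 := hz (1 + Complex.I)
  simp [Matrix.mulVec, dotProduct, Fin.sum_univ_three] at h1 h2 h3 h4 h5 h6
  have e1 := hsymm 0 1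
  have e2 := hsymm 0 2
  have e3 := hsymm 1 2
  apply hdet
  rw [Matrix.det_fin_three]
  have g1 : q 0 0 = 0 := by linarith
  have g2 : q 1 1 = 0 := by linarith
  have g3 : q 0 2 = 0 := by linarith
  have g4 : q 1 2 = 0 := by linarith
  rw [h1, g3, g4, g1, g2]; ring

end

/-! ### Nonvanishing of the determinant -/

/-- A row operation: translation by `c` adds multiples of the row of `T = T*` to those of `S` and
`S*`. One may therefore compute with `c = 0`. -/
theorem circleDet_add_mul {s₂ s₁ s₀ t₂ t₁ t₀ : ℂ} (c : ℂ) (h₂ : conj t₂ = t₀) (h₁ : conj t₁ = t₁)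
    (h₀ : conj t₀ = t₂) :
    circleDet (s₂ + c * t₂) (s₁ + c * t₁) (s₀ + c * t₀) t₂ t₁ t₀
      = circleDet s₂ s₁ s₀ t₂ t₁ t₀ := by
  simp only [circleDet, map_add, map_mul, h₀, h₁, h₂]
  ring

/-- The factors measure, in order, `P` on the outer ellipse, degeneracy of the affine map, `P` at a
focus (`|(P - G₁)(P - G₂)|²`), and a quantity that is positive because `|n| < 1`. -/
theorem circleDet_isogonal (p q m n w : ℂ) :
    circleDet (isogonalNum₂ p q m n w (conj p) (conj q) (conj m) (conj n) (conj w))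
      (isogonalNum₁ p q m n w (conj p) (conj q) (conj m) (conj n) (conj w))
      (isogonalNum₀ p q m n w (conj p) (conj q) (conj m) (conj n) (conj w))
      (isogonalDen₂ p q m n w (conj p) (conj q) (conj m) (conj n) (conj w))
      (isogonalDen₁ p q m n w (conj p) (conj q) (conj m) (conj n) (conj w))
      (isogonalDen₀ p q m n w (conj p) (conj q) (conj m) (conj n) (conj w))
    = -(w * conj w - 1) * (p * conj p - q * conj q)
      * (((p * w + q * conj w) ^ 2 - (p * w + q * conj w) * (p * m + q * conj m)
          + p ^ 2 * n + q ^ 2 * conj n + p * q * (m * conj m - 1 - n * conj n))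
        * conj ((p * w + q * conj w) ^ 2 - (p * w + q * conj w) * (p * m + q * conj m)
          + p ^ 2 * n + q ^ 2 * conj n + p * q * (m * conj m - 1 - n * conj n)))
      * (p * conj p + q * conj q - (p * conj q * n + conj p * q * conj n)) := by
  simp only [circleDet, isogonalNum₀, isogonalNum₁, isogonalNum₂, isogonalDen₀, isogonalDen₁,
    isogonalDen₂, map_add, map_sub, map_neg, map_mul, map_pow, map_one, Complex.conj_conj,
    map_ofNat]
  ring

theorem circleDet_isogonal_ne_zero {p q c f g w G₁ G₂ : ℂ} (hpq : ‖p‖ ≠ ‖q‖) (hf : ‖f‖ < 1)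
    (hg : ‖g‖ < 1) (hsum : G₁ + G₂ = p * (f + g) + q * conj (f + g) + 2 * c)
    (hprod : (G₁ - c) * (G₂ - c) = p ^ 2 * (f * g) + q ^ 2 * conj (f * g)
      + p * q * ((f + g) * conj (f + g) - 1 - f * g * conj (f * g)))
    (hw : ‖w‖ ≠ 1) (h₁ : p * w + q * conj w + c ≠ G₁) (h₂ : p * w + q * conj w + c ≠ G₂) :
    circleDet (isogonalNum₂ p q (f + g) (f * g) w (conj p) (conj q) (conj (f + g)) (conj (f * g)) (conj w))
      (isogonalNum₁ p q (f + g) (f * g) w (conj p) (conj q) (conj (f + g)) (conj (f * g)) (conj w))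
      (isogonalNum₀ p q (f + g) (f * g) w (conj p) (conj q) (conj (f + g)) (conj (f * g)) (conj w))
      (isogonalDen₂ p q (f + g) (f * g) w (conj p) (conj q) (conj (f + g)) (conj (f * g)) (conj w))
      (isogonalDen₁ p q (f + g) (f * g) w (conj p) (conj q) (conj (f + g)) (conj (f * g)) (conj w))
      (isogonalDen₀ p q (f + g) (f * g) w (conj p) (conj q) (conj (f + g)) (conj (f * g)) (conj w))
      ≠ 0 := by
  rw [circleDet_isogonal]
  have hsq {x y : ℝ} (hx : 0 ≤ x) (hy : 0 ≤ y) (hxy : x ≠ y) : x ^ 2 - y ^ 2 ≠ 0 :=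
    sub_ne_zero.2 fun h => hxy ((pow_left_inj₀ hx hy two_ne_zero).1 h)
  have e1 : w * conj w - 1 ≠ 0 := by
    have := hsq (norm_nonneg w) zero_le_one hw
    rw [Complex.mul_conj']
    exact_mod_cast (by simpa using this : ‖w‖ ^ 2 - 1 ≠ 0)
  have e2 : p * conj p - q * conj q ≠ 0 := by
    rw [Complex.mul_conj', Complex.mul_conj']
    exact_mod_cast hsq (norm_nonneg p) (norm_nonneg q) hpq
  have e3 : (p * w + q * conj w) ^ 2 - (p * w + q * conj w) * (p * (f + g) + q * conj (f + g))
      + p ^ 2 * (f * g) + q ^ 2 * conj (f * g)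
      + p * q * ((f + g) * conj (f + g) - 1 - f * g * conj (f * g)) ≠ 0 := by
    have := mul_ne_zero (sub_ne_zero.2 h₁) (sub_ne_zero.2 h₂)
    convert this using 1
    linear_combination (p * w + q * conj w) * hsum - hprod
  have e4 : p * conj p + q * conj q - (p * conj q * (f * g) + conj p * q * conj (f * g)) ≠ 0 := by
    intro h0
    have h1 : p * conj q * (f * g) + conj p * q * conj (f * g) = ((‖p‖ ^ 2 + ‖q‖ ^ 2 : ℝ) : ℂ) := by
      rw [Complex.mul_conj', Complex.mul_conj'] at h0
      push_cast
      linear_combination -h0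
    have h2 := congrArg norm h1
    rw [Complex.norm_real, Real.norm_of_nonneg (by positivity)] at h2
    have h3 : ‖p * conj q * (f * g) + conj p * q * conj (f * g)‖ ≤ 2 * (‖p‖ * ‖q‖) * (‖f‖ * ‖g‖) := by
      refine (norm_add_le _ _).trans (le_of_eq ?_)
      simp only [norm_mul, RCLike.norm_conj]
      ring
    have h4 : ‖f‖ * ‖g‖ ≤ 1 := mul_le_one₀ hf.le (norm_nonneg _) hg.le
    have h5 : 0 < (‖p‖ - ‖q‖) ^ 2 := by
      have := sub_ne_zero.2 hpq
      positivity
    have h6 := mul_le_mul_of_nonneg_left h4 (by positivity : 0 ≤ 2 * (‖p‖ * ‖q‖))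
    nlinarith
  exact mul_ne_zero (mul_ne_zero (mul_ne_zero (neg_ne_zero.2 e1) e2)
    (mul_ne_zero e3 ((_root_.map_ne_zero _).2 e3))) e4

/-! ### Points on the outer ellipse -/

/-- The inversion `μ ↦ 1/(μ - 1)` takes the unit circle without `1` onto the line of real part
`-1/2`. -/
theorem isLineUpToPoint_of_inv {K : Set ℂ} {κ e μ₀ : ℂ} (he : e ≠ 0)
    (hK : ∀ Q, Q ∈ K ↔ ∃ μ : ℂ, ‖μ‖ = 1 ∧ μ ≠ 1 ∧ μ ≠ μ₀ ∧ Q = κ + e / (μ - 1)) :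
    IsLineUpToPoint K := by
  have hmem (Q : ℂ) : Q ∈ line[ℝ, κ - e / 2, κ - e / 2 + Complex.I * e] ↔
      ∃ t : ℝ, Q = κ + e * (-1 / 2 + t * Complex.I) := by
    rw [mem_line_iff]
    refine exists_congr fun t => ?_
    rw [eq_comm, show κ - e / 2 + t * (κ - e / 2 + Complex.I * e - (κ - e / 2))
      = κ + e * (-1 / 2 + t * Complex.I) by ring]
  -- If `μ₀ = 1`, division by zero makes the excluded point `κ`, which is not on the line, so
  -- nothing is lost.
  refine ⟨κ - e / 2, κ - e / 2 + Complex.I * e, κ + e / (μ₀ - 1), ?_, ?_, ?_⟩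
  · intro h
    have : Complex.I * e = 0 := by linear_combination (-1) * h
    simp [he] at this
  · rintro Q ⟨hQ, hQ'⟩
    obtain ⟨t, rfl⟩ := (hmem Q).1 hQ
    have h0 : (-1 / 2 + t * Complex.I : ℂ) ≠ 0 := by
      intro h
      have := congrArg Complex.re h
      simp at this
    have hμ : (1 + 1 / (-1 / 2 + t * Complex.I) : ℂ) - 1 = 1 / (-1 / 2 + t * Complex.I) := by ring
    rw [hK]
    refine ⟨1 + 1 / (-1 / 2 + t * Complex.I), ?_, ?_, ?_, ?_⟩
    · have h1 : (1 + 1 / (-1 / 2 + t * Complex.I) : ℂ)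
          = -conj (-1 / 2 + t * Complex.I) / (-1 / 2 + t * Complex.I) := by
        have h2 : conj (-1 / 2 + t * Complex.I : ℂ) = -1 - (-1 / 2 + t * Complex.I) := by
          rw [map_add, map_div₀, map_neg, map_one, map_ofNat, map_mul, Complex.conj_ofReal,
            Complex.conj_I]
          ring
        rw [h2, eq_div_iff h0, add_mul, one_div_mul_cancel h0]
        ring
      rw [h1, norm_div, norm_neg, RCLike.norm_conj, div_self (norm_ne_zero_iff.2 h0)]
    · rw [← sub_ne_zero, hμ]
      exact one_div_ne_zero h0
    · rintro rfl
      apply hQ'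
      rw [hμ, div_div_eq_mul_div, div_one]
      rfl
    · rw [hμ, div_div_eq_mul_div, div_one]
  · intro Q hQ
    obtain ⟨μ, hμ, hμ1, -, rfl⟩ := (hK Q).1 hQ
    apply (hmem _).2
    have h0 : μ - 1 ≠ 0 := sub_ne_zero.2 hμ1
    have hμ0 : μ ≠ 0 := by rintro rfl; simp at hμ
    refine ⟨(1 / (μ - 1)).im, ?_⟩
    have h1 : (1 / (μ - 1)).re = -1 / 2 := by
      have h2 : 1 / (μ - 1) + conj (1 / (μ - 1)) = -1 := by
        have h3 : μ⁻¹ - 1 ≠ 0 := by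
          rw [sub_ne_zero]
          exact fun h => hμ1 (inv_eq_one.1 h)
        rw [map_div₀, map_sub, map_one, ← Complex.inv_eq_conj hμ]
        have h4 : 1 - μ ≠ 0 := sub_ne_zero.2 hμ1.symm
        have h5 : μ⁻¹ - 1 = (1 - μ) / μ := by field_simp
        rw [h5, one_div_div]
        field_simp
        ring
      rw [Complex.add_conj] at h2
      have h3 : 2 * (1 / (μ - 1)).re = -1 := by exact_mod_cast h2
      linarith
    have h2 := Complex.re_add_im (1 / (μ - 1))
    rw [h1] at h2
    rw [div_eq_mul_one_div e]
    congr 2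
    rw [← h2]
    push_cast
    simp

theorem isLineUpToPoint_isogonal {p q c f g w : ℂ} (hp : p ≠ 0) (hq : q ≠ 0) (hpq : ‖p‖ ≠ ‖q‖)
    (hf : ‖f‖ < 1) (hg : ‖g‖ < 1) (hw : ‖w‖ = 1) :
    IsLineUpToPoint (unitCircleImage (isogonalNum p q c (f + g) (f * g) w)
      (isogonalDen p q (f + g) (f * g) w)) := by
  have hww := mul_conj_of_norm_eq_one hw
  have hw0 : w ≠ 0 := left_ne_zero_of_mul_eq_one hww
  have hw0' : conj w ≠ 0 := right_ne_zero_of_mul_eq_one hww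
  have hp' : conj p ≠ 0 := (_root_.map_ne_zero _).2 hp
  have hq' : conj q ≠ 0 := (_root_.map_ne_zero _).2 hq
  obtain ⟨β, hβ⟩ : ∃ β, β = 1 - conj (f + g) * w + conj (f * g) * w ^ 2 := ⟨_, rfl⟩
  have hβ0 : β ≠ 0 := by
    have hfac : β = (1 - conj f * w) * (1 - conj g * w) := by
      rw [hβ, map_add, map_mul]; ring
    have h1 {x : ℂ} (hx : ‖x‖ < 1) : 1 - conj x * w ≠ 0 := by
      intro h
      have := congrArg norm (sub_eq_zero.1 h)
      rw [norm_mul, RCLike.norm_conj, hw, norm_one] at this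
      linarith
    rw [hfac]
    exact mul_ne_zero (h1 hf) (h1 hg)
  -- `l₁` is the pole of the reduced Möbius map; `l₀` below is the parameter of the triangle with
  -- vertex `w`, where the common factor vanishes.
  obtain ⟨l₁, hl₁⟩ : ∃ l₁, l₁ = conj p * q * conj w / (p * conj q) := ⟨_, rfl⟩
  have hl₁0 : l₁ ≠ 0 := by
    rw [hl₁]
    exact div_ne_zero (mul_ne_zero (mul_ne_zero hp' hq) hw0') (mul_ne_zero hp hq')
  have hl₁n : ‖l₁‖ = 1 := by
    rw [hl₁]
    simp only [norm_div, norm_mul, RCLike.norm_conj, hw, mul_one]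
    exact div_self (mul_ne_zero (norm_ne_zero_iff.2 hp) (norm_ne_zero_iff.2 hq))
  obtain ⟨l₀, hl₀⟩ : ∃ l₀, l₀ = w * (w ^ 2 - (f + g) * w + f * g) / β := ⟨_, rfl⟩
  obtain ⟨u, hu⟩ : ∃ u, u = -p ^ 2 * conj p * conj w ^ 2
        + p * q * conj p * conj (f * g) * conj w ^ 2 - p * q * conj q * conj (f + g) * conj w :=
    ⟨_, rfl⟩
  obtain ⟨v, hv⟩ : ∃ v, v = (p * q * conj p * (f + g) - p * q * conj q * (f * g) * w
      + q ^ 2 * conj q * w) * conj w ^ 2 := ⟨_, rfl⟩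
  obtain ⟨δ, hδ⟩ : ∃ δ, δ = -(p * conj q * conj w) := ⟨_, rfl⟩
  have hδ0 : δ ≠ 0 := by
    rw [hδ]; exact neg_ne_zero.2 (mul_ne_zero (mul_ne_zero hp hq') hw0')
  have hτ (l : ℂ) : conj p * q * conj w ^ 2 - p * conj q * conj w * l = δ * (l - l₁) := by
    rw [hδ, hl₁]; field_simp; ring
  have hβl (l : ℂ) : β * l - w * (w ^ 2 - (f + g) * w + f * g) = β * (l - l₀) := by
    rw [hl₀]; field_simp
  have hT (l : ℂ) : (isogonalDen p q (f + g) (f * g) w).eval l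
      = β * (l - l₀) * (δ * (l - l₁)) := by
    rw [isogonalDen_eval_of_norm_eq_one _ _ _ _ hw, ← hβ, hβl, hτ]
  have hS (l : ℂ) : (isogonalNum p q c (f + g) (f * g) w).eval l
      = β * (l - l₀) * (u * l + v + c * (δ * (l - l₁))) := by
    rw [isogonalNum_eval_of_norm_eq_one _ _ _ _ _ hw, ← hβ, hβl, hτ, ← hu, ← hv]
  -- A zero residue would give `p (x - f)(x - g) = q (1 - f̄ x)(1 - ḡ x)` with `‖x‖ = ‖p‖/‖q‖`. The
  -- Blaschke inequalities then make one side strictly larger, whichever of `‖p‖, ‖q‖` is bigger.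
  have he : u * l₁ + v ≠ 0 := by
    intro h0
    obtain ⟨x, hx⟩ : ∃ x, x = conj p * conj w / conj q := ⟨_, rfl⟩
    have h1 : p * ((x - f) * (x - g)) = q * ((1 - conj f * x) * (1 - conj g * x)) := by
      have hwinv : conj w = w⁻¹ := (Complex.inv_eq_conj hw).symm
      rw [hu, hv, hl₁, hwinv] at h0
      rw [hx, hwinv]
      simp only [map_add, map_mul] at h0
      field_simp at h0 ⊢
      apply mul_left_cancel₀ hq
      linear_combination (-1) * h0
    have h2 := congrArg norm h1
    simp only [norm_mul] at h2
    have hxn : ‖x‖ = ‖p‖ / ‖q‖ := by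
      rw [hx, norm_div, norm_mul, RCLike.norm_conj, RCLike.norm_conj, RCLike.norm_conj, hw, mul_one]
    have hqn : 0 < ‖q‖ := norm_pos_iff.2 hq
    have hpn : 0 < ‖p‖ := norm_pos_iff.2 hp
    rcases lt_or_gt_of_ne hpq with hlt | hgt
    · have hx1 : ‖x‖ < 1 := by rw [hxn, div_lt_one hqn]; exact hlt
      have h3 := mul_lt_mul'' (norm_sub_lt_of_norm_lt_one hf hx1)
        (norm_sub_lt_of_norm_lt_one hg hx1) (norm_nonneg _) (norm_nonneg _)
      have h4 := mul_lt_mul'' hlt h3 (norm_nonneg _)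
        (mul_nonneg (norm_nonneg _) (norm_nonneg _))
      linarith
    · have hx1 : 1 < ‖x‖ := by rw [hxn, one_lt_div hqn]; exact hgt
      have h3 := mul_lt_mul'' (lt_norm_sub_of_one_lt_norm hf hx1)
        (lt_norm_sub_of_one_lt_norm hg hx1) (norm_nonneg _) (norm_nonneg _)
      have h4 := mul_lt_mul'' hgt h3 (norm_nonneg _)
        (mul_nonneg (norm_nonneg _) (norm_nonneg _))
      linarith
  have hval {l : ℂ} (h0 : l ≠ l₀) (h1 : l ≠ l₁) :
      (isogonalNum p q c (f + g) (f * g) w).eval l / (isogonalDen p q (f + g) (f * g) w).eval l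
        = c + u / δ + (u * l₁ + v) / (δ * l₁) / (l / l₁ - 1) := by
    have h0' := sub_ne_zero.2 h0
    have h1' := sub_ne_zero.2 h1
    have h2 : l / l₁ - 1 = (l - l₁) / l₁ := by field_simp
    rw [hS, hT, h2]
    field_simp
    ring
  refine isLineUpToPoint_of_inv (κ := c + u / δ) (e := (u * l₁ + v) / (δ * l₁)) (μ₀ := l₀ / l₁)
    (div_ne_zero he (mul_ne_zero hδ0 hl₁0)) fun Q => ?_
  constructor
  · rintro ⟨l, hl, hTl, rfl⟩
    rw [hT] at hTl
    have h0 : l ≠ l₀ := by rintro rfl; simp at hTl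
    have h1 : l ≠ l₁ := by rintro rfl; simp at hTl
    refine ⟨l / l₁, by rw [norm_div, hl, hl₁n, div_one], ?_, ?_, hval h0 h1⟩
    · rwa [Ne, div_eq_one_iff_eq hl₁0]
    · rwa [Ne, div_left_inj' hl₁0]
  · rintro ⟨μ, hμ, hμ1, hμ0, rfl⟩
    have e1 : l₁ * μ / l₁ = μ := by field_simp
    have h0 : l₁ * μ ≠ l₀ := by rintro rfl; exact hμ0 e1.symm
    have h1 : l₁ * μ ≠ l₁ := by
      intro h; rw [h, div_self hl₁0] at e1; exact hμ1 e1.symm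
    refine ⟨l₁ * μ, by rw [norm_mul, hl₁n, hμ, one_mul], ?_, ?_⟩
    · rw [hT]
      exact mul_ne_zero (mul_ne_zero hβ0 (sub_ne_zero.2 h0)) (mul_ne_zero hδ0 (sub_ne_zero.2 h1))
    · rw [hval h0 h1, e1]

/-! ### Assembling the loci -/

theorem ellipse_comm (F G : ℂ) (s : ℝ) : ellipse F G s = ellipse G F s :=
  Set.ext fun _ => by simp only [ellipse, Set.mem_ofPred_eq, add_comm]

theorem isogonalLocus_eq_unitCircleImage {E K : Set ℂ} {p q c f g : ℂ} {𝒜 : ℂ ≃ᵃ[ℝ] ℂ}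
    (hpq : ‖p‖ ≠ ‖q‖) (hform : ∀ z, 𝒜 z = p * z + q * conj z + c) (hf : ‖f‖ < 1) (hg : ‖g‖ < 1)
    (htri : ∀ x y z : ℂ, IsPonceletTriangle E K (𝒜 x) (𝒜 y) (𝒜 z) ↔
      IsBlaschkeTriple (f + g) (f * g) x y z) (w : ℂ) :
    isogonalLocus E K (𝒜 w) = unitCircleImage (isogonalNum p q c (f + g) (f * g) w)
      (isogonalDen p q (f + g) (f * g) w) := by
  ext Q
  constructor
  · rintro ⟨A, B, C, h, hQ⟩
    obtain ⟨a, rfl⟩ := 𝒜.surjective A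
    obtain ⟨b, rfl⟩ := 𝒜.surjective B
    obtain ⟨d, rfl⟩ := 𝒜.surjective C
    have h' := (htri a b d).1 h
    exact ⟨a * b * d, h'.norm_prod, (h'.isIsogonalConjugate_iff hpq hform w Q).1 hQ⟩
  · rintro ⟨l, hl, hQ⟩
    obtain ⟨a, b, d, h, rfl⟩ := exists_isBlaschkeTriple hf hg hl
    exact ⟨_, _, _, (htri a b d).2 h, (h.isIsogonalConjugate_iff hpq hform w Q).2 hQ⟩

theorem isogonalLocus_focus {E : Set ℂ} {G₁ G₂ p q c m n : ℂ} {r : ℝ} {𝒜 : ℂ ≃ᵃ[ℝ] ℂ}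
    (hK : dist G₁ G₂ < r)
    (hPoncelet : ∃ A B C : ℂ, IsPonceletTriangle E (ellipse G₁ G₂ r) A B C)
    (hpq : ‖p‖ ≠ ‖q‖) (hform : ∀ z, 𝒜 z = p * z + q * conj z + c)
    (htri : ∀ x y z : ℂ, IsPonceletTriangle E (ellipse G₁ G₂ r) (𝒜 x) (𝒜 y) (𝒜 z) ↔
      IsBlaschkeTriple m n x y z)
    (hsum : G₁ + G₂ = p * m + q * conj m + 2 * c)
    (hprod : (G₁ - c) * (G₂ - c) = p ^ 2 * n + q ^ 2 * conj n
      + p * q * (m * conj m - 1 - n * conj n)) :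
    isogonalLocus E (ellipse G₁ G₂ r) G₁ = {G₂} := by
  have key {A B C : ℂ} (h : IsPonceletTriangle E (ellipse G₁ G₂ r) A B C) (Q : ℂ) :
      IsIsogonalConjugate A B C G₁ Q ↔ Q = G₂ := by
    obtain ⟨w, hw⟩ := 𝒜.surjective G₁
    obtain ⟨a, rfl⟩ := 𝒜.surjective A
    obtain ⟨b, rfl⟩ := 𝒜.surjective B
    obtain ⟨d, rfl⟩ := 𝒜.surjective C
    have h' := (htri a b d).1 h
    obtain ⟨ha, hb, hd⟩ := h.ne_focus hK
    have hG : IsIsogonalConjugate (𝒜 a) (𝒜 b) (𝒜 d) G₁ G₂ :=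
      ⟨ha, hb, hd, h'.foci_mem_reflectedCevian hpq hform hsum hprod ha,
        h'.rotate.foci_mem_reflectedCevian hpq hform hsum hprod hb,
        h'.rotate.rotate.foci_mem_reflectedCevian hpq hform hsum hprod hd⟩
    refine ⟨fun hQ => ?_, fun hQ => hQ ▸ hG⟩
    rw [← hw] at hQ hG
    rw [((h'.isIsogonalConjugate_iff hpq hform w Q).1 hQ).2,
      ← ((h'.isIsogonalConjugate_iff hpq hform w G₂).1 hG).2]
  obtain ⟨A, B, C, h⟩ := hPoncelet
  ext Q
  refine ⟨fun ⟨A', B', C', h', hQ⟩ => (key h' Q).1 hQ, fun hQ => ⟨A, B, C, h, (key h Q).2 hQ⟩⟩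

/-- The locus of the isogonal conjugate of a point which is neither on the outer ellipse nor a
focus of the inner one. -/
theorem unitCircleImage_isogonal {p q c f g w G₁ G₂ : ℂ} (hpq : ‖p‖ ≠ ‖q‖) (hf : ‖f‖ < 1)
    (hg : ‖g‖ < 1) (hsum : G₁ + G₂ = p * (f + g) + q * conj (f + g) + 2 * c)
    (hprod : (G₁ - c) * (G₂ - c) = p ^ 2 * (f * g) + q ^ 2 * conj (f * g)
      + p * q * ((f + g) * conj (f + g) - 1 - f * g * conj (f * g)))
    (hw : ‖w‖ ≠ 1) (h₁ : p * w + q * conj w + c ≠ G₁) (h₂ : p * w + q * conj w + c ≠ G₂) :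
    IsNondegenerateConic (unitCircleImage (isogonalNum p q c (f + g) (f * g) w)
      (isogonalDen p q (f + g) (f * g) w)) ∧
    unitCircleImage (isogonalNum p q c (f + g) (f * g) w) (isogonalDen p q (f + g) (f * g) w)
      = {z : ℂ | MvPolynomial.eval ![(z.re : ℂ), (z.im : ℂ)]
        (eliminant (isogonalNum p q c (f + g) (f * g) w)
          (isogonalDen p q (f + g) (f * g) w)) = 0} := by
  have hdet := circleDet_isogonal_ne_zero hpq hf hg hsum hprod hw h₁ h₂
  have hc₂ := conj_isogonalDen₂ p q (f + g) (f * g) w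
  have hc₁ := conj_isogonalDen₁ p q (f + g) (f * g) w
  have hc₀ := congrArg conj hc₂
  rw [Complex.conj_conj] at hc₀
  rw [← circleDet_add_mul c hc₂ hc₁ hc₀.symm] at hdet
  obtain ⟨t₁, ht₁⟩ := Complex.conj_eq_iff_real.1 hc₁
  have hT := isogonalDen.eq_1 p q (f + g) (f * g) w
  have hS := isogonalNum.eq_1 p q c (f + g) (f * g) w
  rw [← hc₂, ht₁] at hT
  rw [← hc₂, ht₁] at hdet
  rw [ht₁, ← hc₂] at hS
  exact ⟨isNondegenerateConic_unitCircleImage hS hT hdet,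
    Set.ext fun z => mem_unitCircleImage_iff hS hT hdet z⟩

theorem natDegree_isogonalNum_le (p q c m n w : ℂ) : (isogonalNum p q c m n w).natDegree ≤ 2 := by
  rw [isogonalNum]; compute_degree

theorem natDegree_isogonalDen_le (p q m n w : ℂ) : (isogonalDen p q m n w).natDegree ≤ 2 := by
  rw [isogonalDen]; compute_degree

theorem totalDegree_eliminant_isogonal_le (p q c m n w : ℂ) :
    (eliminant (isogonalNum p q c m n w) (isogonalDen p q m n w)).totalDegree ≤ 2 := by
  apply totalDegree_eliminant_le
  · have := conj_isogonalDen₂ p q m n w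
    simpa [isogonalDen] using this
  · have := conj_isogonalDen₁ p q m n w
    simpa [isogonalDen] using this

end

theorem mainTheorem2
    (F₁ F₂ : ℂ) (s : ℝ) (_hE : dist F₁ F₂ < s)
    (G₁ G₂ : ℂ) (r : ℝ) (_hK : dist G₁ G₂ < r)
    (_hnested : ellipse G₁ G₂ r ⊆ ellipseInterior F₁ F₂ s)
    (_hPoncelet : ∃ A B C : ℂ, IsPonceletTriangle (ellipse F₁ F₂ s) (ellipse G₁ G₂ r) A B C)
    (P : ℂ) :
    (P ∉ ellipse F₁ F₂ s → P ≠ G₁ → P ≠ G₂ →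
      IsNondegenerateConic (isogonalLocus (ellipse F₁ F₂ s) (ellipse G₁ G₂ r) P)) ∧
    (P = G₁ → isogonalLocus (ellipse F₁ F₂ s) (ellipse G₁ G₂ r) P = {G₂}) ∧
    (P = G₂ → isogonalLocus (ellipse F₁ F₂ s) (ellipse G₁ G₂ r) P = {G₁}) ∧
    (P ∈ ellipse F₁ F₂ s → F₁ ≠ F₂ →
      IsLineUpToPoint (isogonalLocus (ellipse F₁ F₂ s) (ellipse G₁ G₂ r) P)) ∧
    (∀ 𝒜 : ℂ ≃ᵃ[ℝ] ℂ, 𝒜 '' Metric.sphere (0 : ℂ) 1 = ellipse F₁ F₂ s →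
      ∃ S T : Polynomial ℂ, S.natDegree ≤ 2 ∧ T.natDegree ≤ 2 ∧
        (∀ A B C : ℂ, IsPonceletTriangle (ellipse F₁ F₂ s) (ellipse G₁ G₂ r) A B C →
          ∀ Q : ℂ, IsIsogonalConjugate A B C P Q ↔
            T.eval (triangleParameter 𝒜 A B C) ≠ 0 ∧
            Q = S.eval (triangleParameter 𝒜 A B C) / T.eval (triangleParameter 𝒜 A B C)) ∧
        isogonalLocus (ellipse F₁ F₂ s) (ellipse G₁ G₂ r) P =
          {Q : ℂ | ∃ l : ℂ, ‖l‖ = 1 ∧ T.eval l ≠ 0 ∧ Q = S.eval l / T.eval l} ∧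
        (eliminant S T).totalDegree ≤ 2 ∧
        (P ∉ ellipse F₁ F₂ s → P ≠ G₁ → P ≠ G₂ →
          eliminant S T ≠ 0 ∧
          isogonalLocus (ellipse F₁ F₂ s) (ellipse G₁ G₂ r) P =
            {z : ℂ | MvPolynomial.eval ![(z.re : ℂ), (z.im : ℂ)] (eliminant S T) = 0})) := by

  have hmem {𝒜 : ℂ ≃ᵃ[ℝ] ℂ} (h𝒜 : 𝒜 '' Metric.sphere (0 : ℂ) 1 = ellipse F₁ F₂ s) (w : ℂ) :
      𝒜 w ∈ ellipse F₁ F₂ s ↔ ‖w‖ = 1 := by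
    rw [← h𝒜, 𝒜.injective.mem_set_image, mem_sphere_zero_iff_norm]
  obtain ⟨𝒜, p, q, c, h𝒜, hform, hpq, hp, hq⟩ := exists_affineEquiv_image_sphere _hE
  obtain ⟨f, g, hf, hg, htri, hsum, hprod⟩ :=
    exists_blaschke_of_poncelet _hK _hnested _hPoncelet h𝒜 hpq hform
  refine ⟨?_, ?_, ?_, ?_, ?_⟩
  · intro hP h₁ h₂
    obtain ⟨w, rfl⟩ := 𝒜.surjective P
    rw [isogonalLocus_eq_unitCircleImage hpq hform hf hg htri]
    rw [hform] at h₁ h₂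
    exact (unitCircleImage_isogonal hpq hf hg hsum hprod (by rwa [hmem h𝒜] at hP) h₁ h₂).1
  · rintro rfl
    exact isogonalLocus_focus _hK _hPoncelet hpq hform htri hsum hprod
  · rintro rfl
    rw [ellipse_comm G₁] at htri _hPoncelet ⊢
    exact isogonalLocus_focus (by rwa [dist_comm P]) _hPoncelet hpq hform htri
      (by rw [add_comm P, hsum]) (by rw [mul_comm (P - c), hprod])
  · intro hP hF
    obtain ⟨w, rfl⟩ := 𝒜.surjective P
    rw [isogonalLocus_eq_unitCircleImage hpq hform hf hg htri]
    exact isLineUpToPoint_isogonal hp (hq hF) hpq hf hg ((hmem h𝒜 w).1 hP)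
  -- The parametrisation is claimed for every affine map, so the special one, chosen to have `q ≠ 0`
  -- off the circular case, is discarded.
  · clear! 𝒜
    intro 𝒜 h𝒜
    obtain ⟨p, q, c, hform, hpq⟩ := exists_affineEquiv_formula 𝒜
    obtain ⟨f, g, hf, hg, htri, hsum, hprod⟩ :=
      exists_blaschke_of_poncelet _hK _hnested _hPoncelet h𝒜 hpq hform
    obtain ⟨w, rfl⟩ := 𝒜.surjective P
    have hlocus := isogonalLocus_eq_unitCircleImage hpq hform hf hg htri w
    refine ⟨isogonalNum p q c (f + g) (f * g) w, isogonalDen p q (f + g) (f * g) w,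
      natDegree_isogonalNum_le _ _ _ _ _ _, natDegree_isogonalDen_le _ _ _ _ _, ?_, hlocus,
      totalDegree_eliminant_isogonal_le _ _ _ _ _ _, ?_⟩
    · intro A B C h Q
      obtain ⟨a, rfl⟩ := 𝒜.surjective A
      obtain ⟨b, rfl⟩ := 𝒜.surjective B
      obtain ⟨d, rfl⟩ := 𝒜.surjective C
      simp only [triangleParameter, AffineEquiv.symm_apply_apply]
      exact ((htri a b d).1 h).isIsogonalConjugate_iff hpq hform w Q
    · intro hP h₁ h₂
      rw [hmem h𝒜] at hP
      rw [hform] at h₁ h₂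
      obtain ⟨hconic, himage⟩ := unitCircleImage_isogonal hpq hf hg hsum hprod hP h₁ h₂
      refine ⟨fun h0 => hconic.ne_univ ?_, hlocus.trans himage⟩
      rw [himage, h0]
      simp
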